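/- Let $\mathbb T=(\mathbb R\cup\{-\infty\},\max,+)$ be the tropical semifield, let $S\subseteq\mathbb T$ be a sub-semifield different from the Boolean semifield $\{0_{\mathbb T},1_{\mathbb T}\}$, and let $\Gamma=\log(S^\times)\subseteq\mathbb R$ be the corresponding additive group. Let $M$ be a finitely generated free abelian group, $S[M]$ the monoid $S$-algebra of $M$ (finite sums of terms $a\chi^u$, $a\in S$, $u\in M$), and $N_{\mathbb R}=\operatorname{Hom}(M,\mathbb R)$. Semirings are additively idempotent, with canonical order $a\le b\iff a+b=b$. A congruence $P$ on a semiring $A$ is prime if it is proper and $A/P$ is totally ordered (by the canonical order) and cancellative; $\kappa(P)$ is the total semiring of fractions of $A/P$, and $|\cdot|_P:A\to\kappa(P)$ is the canonical map. A totally ordered semifield $K$ is topologized by calling $U\subseteq K$ open if $0\notin U$ or $\{x\in K: x<c\}\subseteq U$ for some $c\in K\setminus\{0\}$. The set $\operatorname{Cont}_S S[M]$ consists of the prime congruences $P$ on $S[M]$ for which $S[M]/P$ is infinite and the map $S\to S[M]\to\kappa(P)$ is continuous. A $\Gamma$-rational polyhedron is a set $\{x\in N_{\mathbb R}:\langle x,u_i\rangle\le\gamma_i,\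 i=1,\dots,q\}$ with $u_i\in M$, $\gamma_i\in\Gamma$; a bounded one is a $\Gamma$-rational polytope. A $\Gamma$-rational polyhedral set is a finite (possibly empty) union of $\Gamma$-rational polyhedra; these sets form a lattice under inclusion, with union and intersection as join and meet. A prime filter on this lattice is a nonempty proper subset $\mathcal F$ of it that is closed under finite intersections and under passing to larger $\Gamma$-rational polyhedral sets, and such that $U_1\cup U_2\in\mathcal F$ implies $U_1\in\mathcal F$ or $U_2\in\mathcal F$. For $f=\sum_u f_u\chi^u\in S[M]$ and $x\in N_{\mathbb R}$ put $f(x)=\max_u(\log f_u+\langle x,u\rangle)$, and for $f_0,\dots,f_n\in S[M]$ put $R(f_0,\dots,f_n)=\{x\in N_{\mathbb R}: f_0(x)\ge f_i(x)\text{ for }1\le i\le n\}$. For a prime congruence $P$ on $S[M]$ let $\mathcal F_P$ be the collection of all $\Gamma$-rational polyhedral sets $U$ for which there are $f_0,\dots,f_n\in S[M]$ with $R(f_0,\dots,f_n)\subseteq U$ and $|f_0|_P\ge|f_i|_P$ for $1\le i\le n$. Then for every $P\in\operatorname{Cont}_S S[M]$ the map $S\to S[M]\to\kappa(P)$ is injective,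 and there is a bijection $$\{P \text{ a prime congruence on } S[M] : S\to S[M]\to\kappa(P)\text{ is injective}\}\longrightarrow\{\text{prime filters on the lattice of }\Gamma\text{-rational polyhedral sets}\}.$$ This bijection extends the bijection $P\mapsto\mathcal F_P$ from $\operatorname{Cont}_S S[M]$ to the set of those prime filters that contain a polytope: it is given by $P\mapsto\mathcal F_P$ for all $P$ in the source, and $P\in\operatorname{Cont}_S S[M]$ if and only if $\mathcal F_P$ contains a $\Gamma$-rational polytope. -/

import Mathlib

noncomputable section

open Function Order

namespace TropicalFilters

/-! ### The tropical semifield and its sub-semifields -/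

/-- The tropical semifield `ℝ ∪ {-∞}` with addition the maximum and multiplication the addition of
real numbers. Mathlib's `Tropical` uses the minimum, so the order of `ℝ` is reversed first; the top
element of `WithTop ℝᵒᵈ` is then `-∞`, the zero of the semifield. The order that `Tropical` puts on
this type is the reverse of the canonical one and is not used below. -/
abbrev MaxPlus : Type := Tropical (WithTop ℝᵒᵈ)

/-- The real number or `-∞` that an element of the tropical semifield stands for. -/
def logT (a : MaxPlus) : WithBot ℝ := WithTop.ofDual (Tropical.untrop a)

/-- `S` is a sub-semifield of the tropical semifield which is not the Boolean semifield `{0, 1}`. -/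
structure IsSubsemifield (S : Subsemiring MaxPlus) : Prop where
  exists_inv : ∀ a ∈ S, a ≠ 0 → ∃ b ∈ S, a * b = 1
  not_boolean : ∃ a ∈ S, a ≠ 0 ∧ a ≠ 1

/-- The subgroup `Γ = log (S \ {0})` of the real numbers, as a set. -/
def valueGroup (S : Subsemiring MaxPlus) : Set ℝ :=
  {γ | ∃ a ∈ S, logT a = (γ : WithBot ℝ)}

/-! ### Prime congruences and residue semifields -/

/-- The canonical relation `a ≤ b` of an additively idempotent semiring. -/
def CanonLE {A : Type*} [Add A] (a b : A) : Prop := a + b = b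

/-- The strict version of the canonical order. -/
def CanonLT {A : Type*} [Add A] (a b : A) : Prop := CanonLE a b ∧ a ≠ b

/-- A proper congruence whose quotient is totally ordered by its canonical order and cancellative. -/
structure IsPrimeCongruence {A : Type*} [CommSemiring A] (P : RingCon A) : Prop where
  proper : P ≠ ⊤
  total : ∀ a b : P.Quotient, CanonLE a b ∨ CanonLE b a
  cancel : ∀ a b c : P.Quotient, a ≠ 0 → a * b = a * c → b = c

/-- The multiplicative submonoid of cancellative elements. -/
def cancellatives (A : Type*) [CommSemiring A] : Submonoid A where
  carrier := {a | ∀ b c : A, a * b = a * c → b = c}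
  one_mem' := by
    intro b c h
    simpa using h
  mul_mem' := by
    intro a a' ha ha' b c h
    apply ha'
    apply ha
    simpa [mul_assoc] using h

/-- The residue semifield of `P`: the total semiring of fractions of the quotient by `P`. -/
abbrev ResidueSemifield {A : Type*} [CommSemiring A] (P : RingCon A) : Type _ :=
  Localization (cancellatives P.Quotient)

/-- The canonical map `a ↦ |a|_P` to the residue semifield. -/
def residueMap {A : Type*} [CommSemiring A] (P : RingCon A) : A →+* ResidueSemifield P :=
  (algebraMap P.Quotient (ResidueSemifield P)).comp P.mk'

/-- The map `S → S[M] → κ(P)`. -/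
def baseToResidue {S M : Type*} [CommSemiring S] [AddCommMonoid M]
    (P : RingCon (AddMonoidAlgebra S M)) : S →+* ResidueSemifield P :=
  (residueMap P).comp (algebraMap S (AddMonoidAlgebra S M))

/-! ### The continuous spectrum -/

/-- The canonical topology of a totally ordered idempotent semifield `K` (as for the target of a
valuation): a set is open if and only if it does not contain `0` or contains `{x | x < c}` for some
nonzero `c`. It is generated by the nonzero points and the sets `{x | x < c}` with `c ≠ 0`. -/
abbrev canonTopology (K : Type*) [CommSemiring K] : TopologicalSpace K :=
  TopologicalSpace.generateFrom
    ({U | ∃ c : K, c ≠ 0 ∧ U = {c}} ∪ {U | ∃ c : K, c ≠ 0 ∧ U = {x | CanonLT x c}})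

/-- The continuous spectrum of `S[M]` over `S`: the prime congruences `P` whose quotient is infinite
and for which `S → S[M] → κ(P)` is continuous, equivalently for which `S[M] → κ(P)` is continuous
for the topology on `S[M]` coinduced from `S`. -/
def contSpec (S M : Type*) [CommSemiring S] [AddCommMonoid M] :
    Set (RingCon (AddMonoidAlgebra S M)) :=
  {P | IsPrimeCongruence P ∧ Infinite P.Quotient ∧
    @Continuous S (ResidueSemifield P) (canonTopology S) (canonTopology (ResidueSemifield P))
      (baseToResidue P)}

/-! ### Rational polyhedral sets in `N_ℝ = Hom(M, ℝ)` -/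

section Polyhedra

variable {M : Type*} [AddCommGroup M]

/-- A set of the form `{x | ⟨x, u_i⟩ ≤ γ_i for i = 1, …, q}` with `u_i` in `M` and `γ_i` in `Γ`. -/
def IsRationalPolyhedron (Γ : Set ℝ) (Q : Set (M →+ ℝ)) : Prop :=
  ∃ (q : ℕ) (u : Fin q → M) (γ : Fin q → ℝ), (∀ i, γ i ∈ Γ) ∧ Q = {x | ∀ i, x (u i) ≤ γ i}

/-- A finite union of `Γ`-rational polyhedra. -/
def IsRationalPolyhedralSet (Γ : Set ℝ) (U : Set (M →+ ℝ)) : Prop :=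
  ∃ (m : ℕ) (Q : Fin m → Set (M →+ ℝ)), (∀ j, IsRationalPolyhedron Γ (Q j)) ∧ U = ⋃ j, Q j

/-- A `Γ`-rational polyhedron that is bounded. For `M` finitely generated, boundedness in the
finite-dimensional space `Hom(M, ℝ)` means that each `u ∈ M` takes bounded values. -/
def IsRationalPolytope (Γ : Set ℝ) (Q : Set (M →+ ℝ)) : Prop :=
  IsRationalPolyhedron Γ Q ∧ ∀ u : M, ∃ B : ℝ, ∀ x ∈ Q, |x u| ≤ B

theorem IsRationalPolyhedron.inter {Γ : Set ℝ} {Q Q' : Set (M →+ ℝ)}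
    (h : IsRationalPolyhedron Γ Q) (h' : IsRationalPolyhedron Γ Q') :
    IsRationalPolyhedron Γ (Q ∩ Q') := by
  obtain ⟨q, u, γ, hγ, rfl⟩ := h
  obtain ⟨q', u', γ', hγ', rfl⟩ := h'
  refine ⟨q + q', Fin.append u u', Fin.append γ γ', ?_, ?_⟩
  · intro i
    refine Fin.addCases (fun i => ?_) (fun i => ?_) i
    · simpa using hγ i
    · simpa using hγ' i
  · ext x
    constructor
    · rintro ⟨hx, hx'⟩ i
      refine Fin.addCases (fun i => ?_) (fun i => ?_) i
      · simpa using hx i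
      · simpa using hx' i
    · intro hx
      exact ⟨fun i => by simpa using hx (Fin.castAdd q' i),
        fun i => by simpa using hx (Fin.natAdd q i)⟩

theorem isRationalPolyhedralSet_of_finite {Γ : Set ℝ} {ι : Type} [Finite ι]
    (Q : ι → Set (M →+ ℝ)) (h : ∀ j, IsRationalPolyhedron Γ (Q j)) :
    IsRationalPolyhedralSet Γ (⋃ j, Q j) := by
  obtain ⟨n, ⟨e⟩⟩ := Finite.exists_equiv_fin ι
  exact ⟨n, fun j => Q (e.symm j), fun j => h _, (e.symm.surjective.iUnion_comp Q).symm⟩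

/-- The lattice of `Γ`-rational polyhedral sets, ordered by inclusion, with union and intersection
as join and meet. -/
def polyhedralLattice (Γ : Set ℝ) (N : Type*) [AddCommGroup N] : Sublattice (Set (N →+ ℝ)) where
  carrier := {U | IsRationalPolyhedralSet Γ U}
  supClosed' := by
    rintro U ⟨m, Q, hQ, rfl⟩ V ⟨m', Q', hQ', rfl⟩
    have h := isRationalPolyhedralSet_of_finite (ι := Fin m ⊕ Fin m') (Sum.elim Q Q')
      (fun j => by rcases j with j | j; exacts [hQ j, hQ' j])
    rw [Set.iUnion_sum] at h
    exact h
  infClosed' := by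
    rintro U ⟨m, Q, hQ, rfl⟩ V ⟨m', Q', hQ', rfl⟩
    have h := isRationalPolyhedralSet_of_finite (ι := Fin m × Fin m')
      (fun j => Q j.1 ∩ Q' j.2) (fun j => (hQ j.1).inter (hQ' j.2))
    have e : (⋃ j, Q j) ∩ (⋃ j, Q' j) = ⋃ j : Fin m × Fin m', Q j.1 ∩ Q' j.2 := by
      ext x
      simp [Set.mem_iUnion]
    rw [← e] at h
    exact h

end Polyhedra

/-! ### The filter of a prime congruence -/

section Filter

variable {M : Type*} [AddCommGroup M] {S : Subsemiring MaxPlus}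

/-- The value `f(x) = max_u (log f_u + ⟨x, u⟩)` in `ℝ ∪ {-∞}` of `f = ∑ f_u χ^u` at `x`. -/
def evalAt (f : AddMonoidAlgebra S M) (x : M →+ ℝ) : WithBot ℝ :=
  f.coeff.support.sup fun u => logT (f.coeff u : MaxPlus) + ((x u : ℝ) : WithBot ℝ)

/-- The rational set `R(f₀, f₁, …, f_n) = {x | f₀(x) ≥ f_i(x) for 1 ≤ i ≤ n}`. -/
def rationalSet (f₀ : AddMonoidAlgebra S M) {n : ℕ} (f : Fin n → AddMonoidAlgebra S M) :
    Set (M →+ ℝ) :=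
  {x | ∀ i, evalAt (f i) x ≤ evalAt f₀ x}

/-- The collection `𝓕_P` of all `Γ`-rational polyhedral sets `U` for which there are `f₀, …, f_n`
with `R(f₀, …, f_n) ⊆ U` and `|f₀|_P ≥ |f_i|_P` for `1 ≤ i ≤ n`. -/
def filterOf (P : RingCon (AddMonoidAlgebra S M)) : Set (polyhedralLattice (valueGroup S) M) :=
  {U | ∃ (f₀ : AddMonoidAlgebra S M) (n : ℕ) (f : Fin n → AddMonoidAlgebra S M),
    rationalSet f₀ f ⊆ (U : Set (M →+ ℝ)) ∧
      ∀ i, CanonLE (residueMap P (f i)) (residueMap P f₀)}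

end Filter

end TropicalFilters

end

noncomputable section

open Function Order

namespace TropicalFilters

/-! ### Logarithms of elements of the tropical semifield -/

/-! Modulo a prime congruence `P` every element of `S[M]` is equivalent to one of its terms, and
terms `aχ^u` with `a ≠ 0` are units. Hence `P` is determined by the terms of class at most `1`,
which form a monoid of affine functions `log a + ⟨x, u⟩` (`termMonoid`). If `S → κ(P)` is injective,
this monoid contains no positive constant. Fourier–Motzkin elimination then makes finitely many of
its members nonpositive at a common real point, and strictly negative where they are not invertible
in the monoid. So any finite set of comparisons modulo `P` is a comparison of values at an actual
point (`exists_point`), which may be taken in any given member of `𝓕_P` (`exists_point_mem`).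
Consequently `f ≤ g` modulo `P` exactly when `{f ≤ g}` lies in `𝓕_P`, so `𝓕_P` determines `P`;
primality of `𝓕_P` is read off at such points.

Conversely, a prime filter `F` yields the congruence of agreement on a member of `F`. It is total
because `{f ≤ g}` and `{g ≤ f}` cover the space, and its filter is `F` because every member of `F`
contains a polyhedron in `F`.

Continuity says that each nonzero element of `κ(P)` strictly dominates the images of all
sufficiently small constants. Applied to `χ^u` for plus and minus a basis of `M`, this produces a
box in `𝓕_P`; conversely, on a polytope every term is bounded below by a constant. -/

theorem logT_injective : Injective logT :=
  WithTop.ofDual.injective.comp Tropical.untrop_injective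

@[simp] theorem logT_zero : logT 0 = ⊥ := rfl

@[simp] theorem logT_one : logT 1 = 0 := rfl

theorem logT_eq_bot {a : MaxPlus} : logT a = ⊥ ↔ a = 0 :=
  ⟨fun h => logT_injective h, fun h => by rw [h, logT_zero]⟩

theorem logT_mul (a b : MaxPlus) : logT (a * b) = logT a + logT b := by
  induction a using Tropical.tropRec with | _ a
  induction b using Tropical.tropRec with | _ b
  cases a <;> cases b <;> rfl

theorem logT_add (a b : MaxPlus) : logT (a + b) = logT a ⊔ logT b := by
  rcases le_total a b with h | h
  · rw [Tropical.add_eq_left h, sup_eq_left.2]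
    exact h
  · rw [Tropical.add_eq_right h, sup_eq_right.2]
    exact h

theorem logT_sum {ι : Type*} (s : Finset ι) (f : ι → MaxPlus) :
    logT (∑ i ∈ s, f i) = s.sup fun i => logT (f i) := by
  classical
  induction s using Finset.induction_on with
  | empty => rfl
  | insert i s hi ih => rw [Finset.sum_insert hi, logT_add, ih, Finset.sup_insert]

theorem canonLE_iff_logT {a b : MaxPlus} : CanonLE a b ↔ logT a ≤ logT b := by
  rw [CanonLE, ← logT_injective.eq_iff, logT_add, sup_eq_right]

theorem exists_logT_eq {a : MaxPlus} (ha : a ≠ 0) : ∃ γ : ℝ, logT a = γ := by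
  cases h : logT a with
  | bot => exact absurd (logT_eq_bot.1 h) ha
  | coe γ => exact ⟨γ, rfl⟩

/-- The tropical number with logarithm `γ`. -/
def expT (γ : ℝ) : MaxPlus := Tropical.trop ((OrderDual.toDual γ : ℝᵒᵈ) : WithTop ℝᵒᵈ)

@[simp] theorem logT_expT (γ : ℝ) : logT (expT γ) = γ := rfl

theorem expT_add (γ δ : ℝ) : expT (γ + δ) = expT γ * expT δ :=
  logT_injective <| by simp [logT_mul]

theorem expT_zero : expT 0 = 1 := rfl

/-! ### The canonical order -/

section CanonicalOrder

variable {A B : Type*} [CommSemiring A] [CommSemiring B] {a b c d : A}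

theorem CanonLE.trans (h : CanonLE a b) (h' : CanonLE b c) : CanonLE a c := by
  unfold CanonLE at *
  rw [← h', ← add_assoc, h]

theorem CanonLE.antisymm (h : CanonLE a b) (h' : CanonLE b a) : a = b := by
  unfold CanonLE at *
  rw [← h', add_comm, h]

theorem CanonLE.map (φ : A →+* B) (h : CanonLE a b) : CanonLE (φ a) (φ b) := by
  unfold CanonLE at *
  rw [← map_add, h]

theorem canonLE_map_iff {φ : A →+* B} (hφ : Injective φ) : CanonLE (φ a) (φ b) ↔ CanonLE a b := by
  rw [CanonLE, CanonLE, ← map_add, hφ.eq_iff]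

theorem CanonLE.mul_left (h : CanonLE a b) (c : A) : CanonLE (c * a) (c * b) := by
  unfold CanonLE at *
  rw [← mul_add, h]

theorem CanonLE.mul (h : CanonLE a b) (h' : CanonLE c d) : CanonLE (a * c) (b * d) :=
  (h'.mul_left a).trans (by simpa only [mul_comm] using h.mul_left d)

theorem CanonLE.add_le (h : CanonLE a c) (h' : CanonLE b c) : CanonLE (a + b) c := by
  unfold CanonLE at *
  rw [add_assoc, h', h]

theorem zero_canonLE (a : A) : CanonLE 0 a := zero_add a

theorem CanonLE.sum_le {ι : Type*} {s : Finset ι} {f : ι → A}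
    (h : ∀ i ∈ s, CanonLE (f i) c) : CanonLE (∑ i ∈ s, f i) c := by
  classical
  induction s using Finset.induction_on with
  | empty => exact zero_canonLE c
  | insert i s hi ih =>
    rw [Finset.sum_insert hi]
    exact (h i (Finset.mem_insert_self i s)).add_le
      (ih fun j hj => h j (Finset.mem_insert_of_mem hj))

theorem canonLE_sum (hA : ∀ a : A, CanonLE a a) {ι : Type*} {s : Finset ι} (f : ι → A) {i : ι}
    (hi : i ∈ s) : CanonLE (f i) (∑ i ∈ s, f i) := by
  classical
  rw [CanonLE, ← Finset.add_sum_erase s f hi, ← add_assoc, hA (f i)]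

theorem exists_sum_eq (hA : ∀ a b : A, CanonLE a b ∨ CanonLE b a) {ι : Type*} {s : Finset ι}
    (hs : s.Nonempty) (f : ι → A) : ∃ i ∈ s, ∑ i ∈ s, f i = f i := by
  classical
  induction hs using Finset.Nonempty.cons_induction with
  | singleton i => exact ⟨i, by simp⟩
  | cons i s hi hs ih =>
    obtain ⟨j, hj, h⟩ := ih
    rw [Finset.sum_cons, h]
    rcases hA (f i) (f j) with h' | h'
    · exact ⟨j, Finset.mem_cons_of_mem hj, h'⟩
    · exact ⟨i, Finset.mem_cons_self i s, by rw [add_comm, h']⟩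

end CanonicalOrder

theorem canonLE_of_mul_left {a b c : MaxPlus} (hc : c ≠ 0) (h : CanonLE (c * a) (c * b)) :
    CanonLE a b := by
  obtain ⟨γ, hγ⟩ := exists_logT_eq hc
  rw [canonLE_iff_logT, logT_mul, logT_mul, hγ] at h
  exact canonLE_iff_logT.2 ((WithBot.add_le_add_iff_left WithBot.coe_ne_bot).1 h)

/-! ### Evaluation at a point -/

section Evaluation

variable {M : Type*} [AddCommGroup M] {S : Subsemiring MaxPlus}

/-- Evaluation at `x`, as a homomorphism of semirings. -/
def evalHom (x : M →+ ℝ) : AddMonoidAlgebra S M →+* MaxPlus :=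
  AddMonoidAlgebra.liftNCRingHom S.subtype
    { toFun := fun u => expT (x u.toAdd)
      map_one' := by simp [expT_zero]
      map_mul' := fun u v => by simp [expT_add] }
    fun _ _ => Commute.all _ _

theorem evalHom_single (x : M →+ ℝ) (u : M) (a : S) :
    evalHom x (AddMonoidAlgebra.single u a) = a * expT (x u) :=
  AddMonoidAlgebra.liftNC_single _ _ _ _

theorem sum_single {M : Type*} (f : AddMonoidAlgebra S M) :
    ∑ u ∈ f.coeff.support, AddMonoidAlgebra.single u (f.coeff u) = f :=
  AddMonoidAlgebra.sum_coeff_single f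

theorem logT_evalHom (x : M →+ ℝ) (f : AddMonoidAlgebra S M) :
    logT (evalHom x f) = evalAt f x := by
  conv_lhs => rw [← sum_single f]
  rw [map_sum, logT_sum, evalAt]
  refine Finset.sup_congr rfl fun u _ => ?_
  rw [evalHom_single, logT_mul, logT_expT]

theorem canonLE_evalHom {x : M →+ ℝ} {f g : AddMonoidAlgebra S M} :
    CanonLE (evalHom x f) (evalHom x g) ↔ evalAt f x ≤ evalAt g x := by
  rw [canonLE_iff_logT, logT_evalHom, logT_evalHom]

theorem evalAt_single (x : M →+ ℝ) (u : M) (a : S) :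
    evalAt (AddMonoidAlgebra.single u a) x = logT a + ((x u : ℝ) : WithBot ℝ) := by
  rw [← logT_evalHom, evalHom_single, logT_mul, logT_expT]

/-- A maximum admits no cancellation, and a nonzero term has a finite value at every real point. -/
theorem evalAt_eq_bot {x : M →+ ℝ} {f : AddMonoidAlgebra S M} : evalAt f x = ⊥ ↔ f = 0 := by
  refine ⟨fun h => ?_, fun h => by rw [← logT_evalHom, h, map_zero, logT_zero]⟩
  rw [evalAt, Finset.sup_eq_bot_iff] at h
  ext u : 2
  by_contra hu
  have := h u (by simpa using hu)
  rw [WithBot.add_eq_bot, logT_eq_bot] at this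
  simp at this
  exact hu this

theorem evalHom_ne_zero {x : M →+ ℝ} {f : AddMonoidAlgebra S M} (hf : f ≠ 0) : evalHom x f ≠ 0 :=
  fun h => hf (evalAt_eq_bot.1 (by rw [← logT_evalHom, h, logT_zero]))

theorem evalAt_le_iff {x : M →+ ℝ} {f : AddMonoidAlgebra S M} {c : WithBot ℝ} :
    evalAt f x ≤ c ↔
      ∀ u ∈ f.coeff.support, evalAt (AddMonoidAlgebra.single u (f.coeff u)) x ≤ c := by
  simp_rw [evalAt_single]
  rw [evalAt, Finset.sup_le_iff]

/-- The value `⊥` is excluded because `f = 0` has no term to offer as a witness. -/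
theorem le_evalAt_iff {x : M →+ ℝ} {f : AddMonoidAlgebra S M} {c : WithBot ℝ} (hc : c ≠ ⊥) :
    c ≤ evalAt f x ↔
      ∃ u ∈ f.coeff.support, c ≤ evalAt (AddMonoidAlgebra.single u (f.coeff u)) x := by
  simp_rw [evalAt_single]
  rw [evalAt, Finset.le_sup_iff (bot_lt_iff_ne_bot.2 hc)]

end Evaluation

/-! ### Fourier–Motzkin elimination -/

/-- A finite system of weak and strict lower and upper bounds for one real number is solvable as
soon as the lower bounds are compatible with the upper bounds. -/
theorem exists_real_between {ι : Type*} (s t : Finset ι) (l u : ι → ℝ) (p : ι → Prop)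
    (h : ∀ i ∈ s, ∀ j ∈ t, l i ≤ u j ∧ (p i ∨ p j → l i < u j)) :
    ∃ y, (∀ i ∈ s, l i ≤ y ∧ (p i → l i < y)) ∧ ∀ j ∈ t, y ≤ u j ∧ (p j → y < u j) := by
  rcases s.eq_empty_or_nonempty with rfl | hs
  · rcases t.eq_empty_or_nonempty with rfl | ht
    · exact ⟨0, by simp⟩
    · obtain ⟨j, -, hj⟩ := t.exists_min_image u ht
      refine ⟨u j - 1, by simp, fun k hk => ?_⟩
      have := hj k hk
      exact ⟨by linarith, fun _ => by linarith⟩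
  · obtain ⟨i, hi, hmax⟩ := s.exists_max_image l hs
    rcases t.eq_empty_or_nonempty with rfl | ht
    · refine ⟨l i + 1, fun k hk => ?_, by simp⟩
      have := hmax k hk
      exact ⟨by linarith, fun _ => by linarith⟩
    · obtain ⟨j, hj, hmin⟩ := t.exists_min_image u ht
      have hij := (h i hi j hj).1
      -- The extreme bounds may coincide, yet strict bounds stay strict at the midpoint: each was
      -- compared with the extreme bound on the opposite side.
      refine ⟨(l i + u j) / 2, fun k hk => ?_, fun k hk => ?_⟩
      · have h1 := hmax k hk
        refine ⟨by linarith, fun hp => ?_⟩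
        have h2 := (h k hk j hj).2 (Or.inl hp)
        linarith
      · have h1 := hmin k hk
        refine ⟨by linarith, fun hp => ?_⟩
        have h2 := (h i hi k hk).2 (Or.inr hp)
        linarith

/-- Invertibility of a positive combination passes to its summands, since `-g` is the sum of `-(m •
g + h)`, `h` and `(m - 1) • g`. In the elimination this carries strictness from either function of a
pair to their combination. -/
theorem neg_mem_of_nsmul_add {G : Type*} [AddCommGroup G] {W : AddSubmonoid G} {g h : G}
    (hg : g ∈ W) (hh : h ∈ W) {m : ℕ} (hm : 0 < m) (hW : -(m • g + h) ∈ W) : -g ∈ W := by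
  obtain ⟨m, rfl⟩ := Nat.exists_eq_succ_of_ne_zero hm.ne'
  have : -g = -((m + 1) • g + h) + h + m • g := by
    rw [succ_nsmul]
    abel
  rw [this]
  exact add_mem (add_mem hW hh) (nsmul_mem hg m)

/-- Let `W` be an additive monoid of affine functions on `ℝⁿ` with integral linear part such that
all constants in `W` are nonpositive. For finitely many members of `W` there is a point at which
they are all nonpositive, and negative unless they are invertible in `W`. -/
theorem exists_point_forall_nonpos (n : ℕ) (W : AddSubmonoid (ℝ × (Fin n → ℤ)))
    (hW : ∀ γ : ℝ, (γ, 0) ∈ W → γ ≤ 0) (s : Finset (ℝ × (Fin n → ℤ))) (hs : ∀ g ∈ s, g ∈ W) :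
    ∃ x : Fin n → ℝ, ∀ g ∈ s, g.1 + ∑ i, g.2 i * x i ≤ 0 ∧
      (-g ∉ W → g.1 + ∑ i, g.2 i * x i < 0) := by
  classical
  induction n with
  | zero =>
    refine ⟨0, fun g hg => ?_⟩
    obtain ⟨γ, v⟩ := g
    obtain rfl : v = 0 := Subsingleton.elim _ _
    have h := hW γ (hs _ hg)
    refine ⟨by simpa using h, fun hn => ?_⟩
    refine lt_of_le_of_ne (by simpa using h) fun h0 => hn ?_
    have : γ = 0 := by simpa using h0
    subst this
    simpa using hs _ hg
  | succ n ih =>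
    let e : ℝ × (Fin n → ℤ) →+ ℝ × (Fin (n + 1) → ℤ) :=
      { toFun := fun g => (g.1, Fin.cons 0 g.2)
        map_zero' := by
          ext i
          · rfl
          · refine Fin.cases ?_ (fun i => ?_) i <;> simp
        map_add' := fun g h => by
          ext i
          · rfl
          · refine Fin.cases ?_ (fun i => ?_) i <;> simp }
    have he : ∀ g : ℝ × (Fin (n + 1) → ℤ), g.2 0 = 0 → e (g.1, Fin.tail g.2) = g := by
      intro g hg
      ext i
      · rfl
      · refine Fin.cases ?_ (fun i => ?_) i
        · exact hg.symm
        · rfl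
    -- The natural multiples keep the combination in `W` and cancel the first variable. Truncation
    -- by `toNat` is harmless because `g` is taken from `sN` and `h` from `sP`.
    let comb : ℝ × (Fin (n + 1) → ℤ) → ℝ × (Fin (n + 1) → ℤ) → ℝ × (Fin (n + 1) → ℤ) :=
      fun g h => (h.2 0).toNat • g + (-g.2 0).toNat • h
    let r : ℝ × (Fin (n + 1) → ℤ) → ℝ × (Fin n → ℤ) := fun g => (g.1, Fin.tail g.2)
    let sN := s.filter fun g => g.2 0 < 0
    let sZ := s.filter fun g => g.2 0 = 0
    let sP := s.filter fun g => 0 < g.2 0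
    have hcomb_snd : ∀ g ∈ sN, ∀ h ∈ sP, ∀ i,
        (comb g h).2 i = h.2 0 * g.2 i + -g.2 0 * h.2 i := by
      intro g hg h hh i
      have hg0 : g.2 0 < 0 := (Finset.mem_filter.1 hg).2
      have hh0 : 0 < h.2 0 := (Finset.mem_filter.1 hh).2
      simp only [comb, Prod.snd_add, Prod.smul_snd, Pi.add_apply, Pi.smul_apply]
      rw [nsmul_eq_mul, nsmul_eq_mul, Int.toNat_of_nonneg hh0.le, Int.toNat_of_nonneg (by omega)]
    have hcomb_fst : ∀ g ∈ sN, ∀ h ∈ sP,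
        (comb g h).1 = h.2 0 * g.1 + -g.2 0 * h.1 := by
      intro g hg h hh
      have hg0 : g.2 0 < 0 := (Finset.mem_filter.1 hg).2
      have hh0 : 0 < h.2 0 := (Finset.mem_filter.1 hh).2
      simp only [comb, Prod.fst_add, Prod.smul_fst]
      rw [nsmul_eq_mul, nsmul_eq_mul, ← Int.cast_natCast, ← Int.cast_natCast (-g.2 0).toNat,
        Int.toNat_of_nonneg hh0.le, Int.toNat_of_nonneg (by omega), Int.cast_neg]
    have hcomb : ∀ g ∈ sN, ∀ h ∈ sP, e (r (comb g h)) = comb g h := by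
      intro g hg h hh
      refine he _ ?_
      rw [hcomb_snd g hg h hh]
      ring
    obtain ⟨x, hx⟩ := ih (W.comap e) (fun γ hγ => hW γ (by
        have : e (γ, 0) = (γ, 0) := he (γ, 0) rfl
        rw [← this]
        exact hγ))
      (sZ.image r ∪ (sN ×ˢ sP).image fun q => r (comb q.1 q.2)) (by
        intro g hg
        rw [AddSubmonoid.mem_comap]
        rcases Finset.mem_union.1 hg with hg | hg
        · obtain ⟨g, hg', rfl⟩ := Finset.mem_image.1 hg
          obtain ⟨hgs, hg0⟩ := Finset.mem_filter.1 hg'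
          rw [he g hg0]
          exact hs g hgs
        · obtain ⟨⟨g, h⟩, hq, rfl⟩ := Finset.mem_image.1 hg
          obtain ⟨hg, hh⟩ := Finset.mem_product.1 hq
          rw [hcomb g hg h hh]
          exact add_mem (nsmul_mem (hs g (Finset.mem_filter.1 hg).1) _)
            (nsmul_mem (hs h (Finset.mem_filter.1 hh).1) _))
    let c : ℝ × (Fin (n + 1) → ℤ) → ℝ := fun g => g.1 + ∑ i, Fin.tail g.2 i * x i
    -- The zero of `g` in the eliminated variable: a lower bound for that variable on `sN`, an upper
    -- bound on `sP`.
    let b : ℝ × (Fin (n + 1) → ℤ) → ℝ := fun g => -c g / g.2 0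
    obtain ⟨y, hyN, hyP⟩ := exists_real_between sN sP b b (fun g => -g ∉ W) (by
      intro g hg h hh
      have hxq := hx (r (comb g h)) (Finset.mem_union_right _ (Finset.mem_image.2
        ⟨(g, h), Finset.mem_product.2 ⟨hg, hh⟩, rfl⟩))
      rw [AddSubmonoid.mem_comap, map_neg, hcomb g hg h hh] at hxq
      obtain ⟨hgs, hg0⟩ := Finset.mem_filter.1 hg
      obtain ⟨hhs, hh0⟩ := Finset.mem_filter.1 hh
      have hgR : ((g.2 0 : ℤ) : ℝ) < 0 := by exact_mod_cast hg0
      have hhR : (0 : ℝ) < ((h.2 0 : ℤ) : ℝ) := by exact_mod_cast hh0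
      have hval : (r (comb g h)).1 + ∑ i, (r (comb g h)).2 i * x i =
          h.2 0 * c g + -g.2 0 * c h := by
        simp only [r, c, Fin.tail, hcomb_fst g hg h hh, hcomb_snd g hg h hh, Int.cast_add,
          Int.cast_mul, Int.cast_neg, add_mul, Finset.sum_add_distrib, mul_add, Finset.mul_sum,
          mul_assoc]
        ring
      rw [hval] at hxq
      -- The gap between the two bounds is minus the value of the combination, divided by a positive
      -- number.
      have hb : b h - b g = -(h.2 0 * c g + -g.2 0 * c h) / (h.2 0 * -g.2 0) := by
        have hg1 := hgR.ne
        have hh1 := hhR.ne'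
        simp only [b]
        field_simp
        ring
      have hpos : (0 : ℝ) < h.2 0 * -g.2 0 := mul_pos hhR (by linarith)
      refine ⟨?_, fun hp => ?_⟩
      · rw [← sub_nonneg, hb]
        exact div_nonneg (by linarith [hxq.1]) hpos.le
      · rw [← sub_pos, hb]
        refine div_pos (neg_pos.2 (hxq.2 fun hm => ?_)) hpos
        rcases hp with hp | hp
        · exact hp (neg_mem_of_nsmul_add (hs g hgs) (nsmul_mem (hs h hhs) _) (by omega) hm)
        · refine hp (neg_mem_of_nsmul_add (hs h hhs) (nsmul_mem (hs g hgs) (h.2 0).toNat)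
            (m := (-g.2 0).toNat) (by omega) ?_)
          rwa [add_comm (_ • h)])
    refine ⟨Fin.cons y x, fun g hg => ?_⟩
    have hval : g.1 + ∑ i, (g.2 i : ℝ) * (Fin.cons y x : Fin (n + 1) → ℝ) i = c g + g.2 0 * y := by
      rw [Fin.sum_univ_succ]
      simp only [Fin.cons_zero, Fin.cons_succ, c, Fin.tail]
      ring
    rw [hval]
    rcases lt_trichotomy (g.2 0) 0 with h0 | h0 | h0
    · have hy := hyN g (Finset.mem_filter.2 ⟨hg, h0⟩)
      have h0R : ((g.2 0 : ℤ) : ℝ) < 0 := by exact_mod_cast h0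
      simp only [b, div_le_iff_of_neg h0R, div_lt_iff_of_neg h0R] at hy
      exact ⟨by linarith [hy.1], fun hn => by linarith [hy.2 hn]⟩
    · have hxg := hx (r g) (Finset.mem_union_left _ (Finset.mem_image_of_mem r
        (Finset.mem_filter.2 ⟨hg, h0⟩)))
      rw [AddSubmonoid.mem_comap, map_neg, he g h0] at hxg
      simpa [h0, c] using hxg
    · have hy := hyP g (Finset.mem_filter.2 ⟨hg, h0⟩)
      have h0R : (0 : ℝ) < ((g.2 0 : ℤ) : ℝ) := by exact_mod_cast h0
      simp only [b, le_div_iff₀ h0R, lt_div_iff₀ h0R] at hy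
      exact ⟨by linarith [hy.1], fun hn => by linarith [hy.2 hn]⟩

section General

variable {M : Type*} [AddCommGroup M]

/-- The statement of `exists_point_forall_nonpos` without coordinates. -/
theorem exists_addMonoidHom_forall_nonpos [Module.Free ℤ M] [Module.Finite ℤ M]
    (W : AddSubmonoid (ℝ × M)) (hW : ∀ γ : ℝ, (γ, 0) ∈ W → γ ≤ 0) (s : Finset (ℝ × M))
    (hs : ∀ g ∈ s, g ∈ W) :
    ∃ x : M →+ ℝ, ∀ g ∈ s, g.1 + x g.2 ≤ 0 ∧ (-g ∉ W → g.1 + x g.2 < 0) := by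
  classical
  let φ : M ≃+ (Fin (Module.finrank ℤ M) → ℤ) := (Module.finBasis ℤ M).equivFun.toAddEquiv
  let ψ : ℝ × M ≃+ ℝ × (Fin (Module.finrank ℤ M) → ℤ) := (AddEquiv.refl ℝ).prodCongr φ
  obtain ⟨x, hx⟩ := exists_point_forall_nonpos _ (W.comap ψ.symm.toAddMonoidHom)
    (fun γ hγ => hW γ (by
      have h : ψ.symm (γ, 0) = (γ, 0) := Prod.ext rfl (map_zero φ.symm)
      rw [← h]
      exact hγ))
    (s.image ψ) (by
      intro g hg
      obtain ⟨g, hgs, rfl⟩ := Finset.mem_image.1 hg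
      have h : ψ.symm (ψ g) = g := ψ.symm_apply_apply g
      show ψ.symm (ψ g) ∈ W
      rw [h]
      exact hs g hgs)
  refine ⟨
    { toFun := fun u => ∑ i, φ u i * x i
      map_zero' := by simp
      map_add' := fun u v => by simp [add_mul, Finset.sum_add_distrib] }, fun g hg => ?_⟩
  have h := hx (ψ g) (Finset.mem_image_of_mem _ hg)
  refine ⟨h.1, fun hn => h.2 fun hm => hn ?_⟩
  have h' : ψ.symm (-ψ g) = -g := by rw [← map_neg, ψ.symm_apply_apply]
  rw [← h']
  exact hm

end General

/-! ### Prime congruences as orders on terms -/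

section PrimeCongruence

variable {M : Type*} [AddCommGroup M] {S : Subsemiring MaxPlus}
  {P : RingCon (AddMonoidAlgebra S M)}

open AddMonoidAlgebra (single)

theorem canonLE_coe {a b : S} : CanonLE (a : MaxPlus) b ↔ CanonLE a b :=
  canonLE_map_iff (φ := S.subtype) Subtype.val_injective

theorem canonLE_total (a b : S) : CanonLE a b ∨ CanonLE b a := by
  simp only [← canonLE_coe, canonLE_iff_logT]
  exact le_total _ _

theorem canonLE_single (u : M) {a b : S} (h : CanonLE a b) : CanonLE (single u a) (single u b) := by
  rw [CanonLE, ← AddMonoidAlgebra.single_add, h]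

theorem logT_coe_injective : Injective fun a : S => logT a :=
  logT_injective.comp Subtype.val_injective

theorem IsSubsemifield.exists_mul_eq_one (hS : IsSubsemifield S) {a : S} (ha : a ≠ 0) :
    ∃ b : S, a * b = 1 := by
  obtain ⟨b, hb, h⟩ := hS.exists_inv a a.2 (by simpa using ha)
  exact ⟨⟨b, hb⟩, Subtype.ext h⟩

/-- The canonical map from the quotient to the residue semifield is injective. -/
theorem algebraMap_residue_injective {A : Type*} [CommSemiring A] (P : RingCon A) :
    Injective (algebraMap P.Quotient (ResidueSemifield P)) := by
  intro a b h
  obtain ⟨c, hc⟩ := (IsLocalization.eq_iff_exists (cancellatives P.Quotient) _).1 h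
  exact c.2 a b hc

theorem canonLE_residueMap {A : Type*} [CommSemiring A] {P : RingCon A} {f g : A} :
    CanonLE (residueMap P f) (residueMap P g) ↔ CanonLE (P.mk' f) (P.mk' g) :=
  canonLE_map_iff (algebraMap_residue_injective P)

theorem residueMap_eq_iff {A : Type*} [CommSemiring A] {P : RingCon A} {f g : A} :
    residueMap P f = residueMap P g ↔ P.mk' f = P.mk' g :=
  (algebraMap_residue_injective P).eq_iff

theorem mk_eq_mk_iff {A : Type*} [CommSemiring A] {P : RingCon A} {f g : A} :
    P.mk' f = P.mk' g ↔ P f g :=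
  P.eq

/-- If `S → κ(P)` is injective, it reflects the order. -/
theorem canonLE_of_mk_single (hinj : Injective (baseToResidue P)) {a b : S}
    (h : CanonLE (P.mk' (single (0 : M) a)) (P.mk' (single (0 : M) b))) : CanonLE a b := by
  rcases canonLE_total a b with h' | h'
  · exact h'
  · have h1 := CanonLE.antisymm (A := P.Quotient) h
      (CanonLE.map (B := P.Quotient) P.mk' (canonLE_single (0 : M) h'))
    have h2 : a = b := hinj (residueMap_eq_iff.2 h1)
    subst h2
    exact h'

namespace IsPrimeCongruence

theorem canonLE_refl {A : Type*} [CommSemiring A] {P : RingCon A} (hP : IsPrimeCongruence P)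
    (a : P.Quotient) : CanonLE a a :=
  (hP.total a a).elim id id

theorem one_ne_zero {A : Type*} [CommSemiring A] {P : RingCon A} (hP : IsPrimeCongruence P) :
    (1 : P.Quotient) ≠ 0 := by
  intro h
  refine hP.proper (eq_top_iff.2 fun f g _ => ?_)
  rw [← mk_eq_mk_iff, ← mul_one (P.mk' f), ← mul_one (P.mk' g), h, mul_zero, mul_zero]

/-- Such a term is a unit of `S[M]`, its inverse being the term at `-u` with the inverse
coefficient. -/
theorem mk_single_ne_zero (hP : IsPrimeCongruence P) (hS : IsSubsemifield S) (u : M) {a : S}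
    (ha : a ≠ 0) : P.mk' (single u a) ≠ 0 := by
  obtain ⟨b, hb⟩ := hS.exists_mul_eq_one ha
  intro h
  have h' : P.mk' (single u a * single (-u) b) = 0 := by rw [map_mul, h, zero_mul]
  rw [AddMonoidAlgebra.single_mul_single, hb, add_neg_cancel, ← AddMonoidAlgebra.one_def,
    map_one] at h'
  exact hP.one_ne_zero h'

/-- Every nonzero element of `S[M]` has the same class as one of its terms. -/
theorem exists_mk_eq_mk_single (hP : IsPrimeCongruence P) {f : AddMonoidAlgebra S M} (hf : f ≠ 0) :
    ∃ u ∈ f.coeff.support, P.mk' f = P.mk' (single u (f.coeff u)) := by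
  have hs : f.coeff.support.Nonempty := by
    rw [Finsupp.support_nonempty_iff]
    simpa using hf
  obtain ⟨u, hu, h⟩ := exists_sum_eq hP.total hs fun u => P.mk' (single u (f.coeff u))
  refine ⟨u, hu, ?_⟩
  rw [← h, ← map_sum, sum_single]

theorem mk_eq_zero_iff (hP : IsPrimeCongruence P) (hS : IsSubsemifield S)
    {f : AddMonoidAlgebra S M} : P.mk' f = 0 ↔ f = 0 := by
  refine ⟨fun h => ?_, fun h => by rw [h, map_zero]⟩
  by_contra hf
  obtain ⟨u, hu, h'⟩ := hP.exists_mk_eq_mk_single hf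
  exact hP.mk_single_ne_zero hS u (Finsupp.mem_support_iff.1 hu) (h' ▸ h)

theorem mk_canonLE_iff (hP : IsPrimeCongruence P) {f : AddMonoidAlgebra S M} {c : P.Quotient} :
    CanonLE (P.mk' f) c ↔
      ∀ u ∈ f.coeff.support, CanonLE (P.mk' (single u (f.coeff u))) c := by
  have h : P.mk' f = ∑ u ∈ f.coeff.support, P.mk' (single u (f.coeff u)) := by
    rw [← map_sum, sum_single]
  rw [h]
  exact ⟨fun H u hu => (canonLE_sum hP.canonLE_refl (fun u => P.mk' (single u (f.coeff u)))
    hu).trans H, CanonLE.sum_le (A := P.Quotient)⟩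

theorem canonLE_mk_iff (hP : IsPrimeCongruence P) {f : AddMonoidAlgebra S M} {c : P.Quotient}
    (hc : c ≠ 0) :
    CanonLE c (P.mk' f) ↔
      ∃ u ∈ f.coeff.support, CanonLE c (P.mk' (single u (f.coeff u))) := by
  constructor
  · intro h
    rcases eq_or_ne f 0 with rfl | hf
    · rw [map_zero] at h
      exact absurd (h.antisymm (zero_canonLE c)) hc
    · obtain ⟨u, hu, h'⟩ := hP.exists_mk_eq_mk_single hf
      exact ⟨u, hu, h' ▸ h⟩
  · rintro ⟨u, hu, h⟩
    exact CanonLE.trans (A := P.Quotient) h ((hP.mk_canonLE_iff).1 (hP.canonLE_refl _) u hu)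

/-- The terms whose class is at most `1`, a term `aχ^u` being written as `(log a, u)`. -/
def termMonoid (hP : IsPrimeCongruence P) : AddSubmonoid (ℝ × M) where
  carrier := {g | ∃ a : S, logT a = (g.1 : WithBot ℝ) ∧ CanonLE (P.mk' (single g.2 a)) 1}
  zero_mem' := ⟨1, rfl, by
    rw [Prod.snd_zero, ← AddMonoidAlgebra.one_def, map_one]
    exact hP.canonLE_refl 1⟩
  add_mem' := by
    rintro g h ⟨a, ha, hg⟩ ⟨b, hb, hh⟩
    refine ⟨a * b, ?_, ?_⟩
    · rw [Subsemiring.coe_mul, logT_mul, ha, hb, Prod.fst_add, WithBot.coe_add]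
    · rw [Prod.snd_add, ← AddMonoidAlgebra.single_mul_single, map_mul]
      simpa using CanonLE.mul (A := P.Quotient) hg hh

/-- Dividing by the unit `bχ^v` turns a comparison of two terms into a comparison with `1`; the
quotient of the coefficients lies in `S` and has logarithm `γ - δ`. -/
theorem sub_mem_termMonoid (hP : IsPrimeCongruence P) (hS : IsSubsemifield S) {a b : S} {u v : M}
    {γ δ : ℝ} (ha : logT a = (γ : WithBot ℝ)) (hb : logT b = (δ : WithBot ℝ)) :
    (γ, u) - (δ, v) ∈ hP.termMonoid ↔
      CanonLE (P.mk' (single u a)) (P.mk' (single v b)) := by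
  have hb0 : b ≠ 0 := by
    rintro rfl
    simp at hb
  obtain ⟨c, hc⟩ := hS.exists_mul_eq_one hb0
  obtain ⟨ε, hε⟩ := exists_logT_eq (a := (c : MaxPlus)) (by
    intro h0
    have : c = 0 := Subtype.ext h0
    rw [this, mul_zero] at hc
    exact absurd (congrArg (fun a : S => logT a) hc) (by simp))
  have hδε : δ + ε = 0 := by
    have := congrArg (fun a : S => logT a) hc
    simp only [Subsemiring.coe_mul, logT_mul, hb, hε, Subsemiring.coe_one, logT_one] at this
    exact_mod_cast this
  have hac : logT ((a * c : S) : MaxPlus) = ((γ - δ : ℝ) : WithBot ℝ) := by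
    rw [Subsemiring.coe_mul, logT_mul, ha, hε, ← WithBot.coe_add]
    congr 1
    linarith
  constructor
  · rintro ⟨d, hd, h⟩
    obtain rfl : d = a * c := logT_coe_injective (hd.trans hac.symm)
    have h' := h.mul_left (P.mk' (single v b))
    rw [mul_one, ← map_mul, AddMonoidAlgebra.single_mul_single] at h'
    rwa [mul_left_comm, hc, mul_one, Prod.mk_sub_mk, add_sub_cancel] at h'
  · intro h
    refine ⟨a * c, hac, ?_⟩
    have h' := h.mul_left (P.mk' (single (-v) c))
    rw [← map_mul, ← map_mul, AddMonoidAlgebra.single_mul_single,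
      AddMonoidAlgebra.single_mul_single, neg_add_cancel, mul_comm c b, hc,
      ← AddMonoidAlgebra.one_def, map_one] at h'
    rwa [mul_comm c a, neg_add_eq_sub] at h'

/-- This is the condition on constants that the elimination theorem requires; injectivity supplies
it by reflecting the order of classes back to `S`. -/
theorem nonpos_of_mem_termMonoid (hP : IsPrimeCongruence P) (hinj : Injective (baseToResidue P))
    (γ : ℝ) (h : (γ, 0) ∈ hP.termMonoid) : γ ≤ 0 := by
  obtain ⟨a, ha, h⟩ := h
  have h' : CanonLE a 1 := canonLE_of_mk_single hinj (by
    rw [← AddMonoidAlgebra.one_def, map_one]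
    exact h)
  rw [← canonLE_coe, canonLE_iff_logT, ha, Subsemiring.coe_one, logT_one] at h'
  exact_mod_cast h'

/-- On finitely many elements of `S[M]`, the order of the residue semifield agrees with the order
of values at some point of `Hom(M, ℝ)`. -/
theorem exists_point [Module.Free ℤ M] [Module.Finite ℤ M] (hP : IsPrimeCongruence P)
    (hS : IsSubsemifield S) (hinj : Injective (baseToResidue P))
    (s : Finset (AddMonoidAlgebra S M)) :
    ∃ x : M →+ ℝ, ∀ f ∈ s, ∀ g ∈ s,
      (CanonLE (P.mk' f) (P.mk' g) ↔ evalAt f x ≤ evalAt g x) := by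
  classical
  -- The default `0` never matters: `τ f u` is used only for `u` in the support of `f`.
  let τ : AddMonoidAlgebra S M → M → ℝ × M := fun f u => ((logT (f.coeff u : MaxPlus)).unbotD 0, u)
  have hτ : ∀ f : AddMonoidAlgebra S M, ∀ u ∈ f.coeff.support,
      logT (f.coeff u : MaxPlus) = ((τ f u).1 : WithBot ℝ) := by
    intro f u hu
    obtain ⟨γ, hγ⟩ := exists_logT_eq (a := (f.coeff u : MaxPlus)) (by
      simpa using Finsupp.mem_support_iff.1 hu)
    simp [τ, hγ]
  let T : Finset (ℝ × M) := s.biUnion fun f => f.coeff.support.image (τ f)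
  have hT : ∀ f ∈ s, ∀ u ∈ f.coeff.support, τ f u ∈ T := fun f hf u hu =>
    Finset.mem_biUnion.2 ⟨f, hf, Finset.mem_image_of_mem _ hu⟩
  obtain ⟨x, hx⟩ := exists_addMonoidHom_forall_nonpos hP.termMonoid
    (hP.nonpos_of_mem_termMonoid hinj)
    (((T ×ˢ T).image fun q => q.1 - q.2).filter fun g => g ∈ hP.termMonoid)
    fun g hg => (Finset.mem_filter.1 hg).2
  have hmem : ∀ p ∈ T, ∀ q ∈ T, p - q ∈ hP.termMonoid →
      p - q ∈ ((T ×ˢ T).image fun q => q.1 - q.2).filter fun g => g ∈ hP.termMonoid :=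
    fun p hp q hq h => Finset.mem_filter.2
      ⟨Finset.mem_image.2 ⟨(p, q), Finset.mem_product.2 ⟨hp, hq⟩, rfl⟩, h⟩
  have key : ∀ f ∈ s, ∀ g ∈ s, ∀ u ∈ f.coeff.support, ∀ v ∈ g.coeff.support,
      (CanonLE (P.mk' (single u (f.coeff u))) (P.mk' (single v (g.coeff v))) ↔
        evalAt (single u (f.coeff u)) x ≤ evalAt (single v (g.coeff v)) x) := by
    intro f hf g hg u hu v hv
    rw [evalAt_single, evalAt_single, hτ f u hu, hτ g v hv, ← WithBot.coe_add, ← WithBot.coe_add,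
      WithBot.coe_le_coe, ← hP.sub_mem_termMonoid hS (hτ f u hu) (hτ g v hv)]
    constructor
    · intro h
      have := (hx _ (hmem _ (hT f hf u hu) _ (hT g hg v hv) h)).1
      simp only [Prod.fst_sub, Prod.snd_sub, map_sub, τ] at this ⊢
      linarith
    · intro h
      by_contra hn
      -- Totality puts the reverse difference into the monoid. It is not invertible there, so its
      -- value at `x` is strictly negative, against the assumed inequality.
      have hr : (τ g v) - (τ f u) ∈ hP.termMonoid := by
        refine (hP.sub_mem_termMonoid hS (hτ g v hv) (hτ f u hu)).2
          ((hP.total _ _).resolve_right fun h' => hn ?_)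
        exact (hP.sub_mem_termMonoid hS (hτ f u hu) (hτ g v hv)).2 h'
      have := (hx _ (hmem _ (hT g hg v hv) _ (hT f hf u hu) hr)).2 (by
        rw [neg_sub]
        exact hn)
      simp only [Prod.fst_sub, Prod.snd_sub, map_sub, τ] at this h
      linarith
  refine ⟨x, fun f hf g hg => ?_⟩
  -- Modulo `P` and at `x` alike, `f ≤ g` means that each term of `f` is at most some term of `g`.
  rw [hP.mk_canonLE_iff, evalAt_le_iff]
  refine forall₂_congr fun u hu => ?_
  have hu0 : f.coeff u ≠ 0 := Finsupp.mem_support_iff.1 hu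
  rw [hP.canonLE_mk_iff (hP.mk_single_ne_zero hS u hu0), le_evalAt_iff (by
    rw [Ne, evalAt_eq_bot, AddMonoidAlgebra.single_eq_zero]
    exact hu0)]
  exact exists_congr fun v => and_congr_right fun hv => key f hf g hg u hu v hv

end IsPrimeCongruence

end PrimeCongruence

open AddMonoidAlgebra (single)

variable {M : Type*} [AddCommGroup M] {S : Subsemiring MaxPlus}

/-! ### Polyhedral sets -/

theorem IsRationalPolyhedron.isRationalPolyhedralSet {Γ : Set ℝ} {Q : Set (M →+ ℝ)}
    (h : IsRationalPolyhedron Γ Q) : IsRationalPolyhedralSet Γ Q := by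
  refine ⟨1, fun _ => Q, fun _ => h, ?_⟩
  rw [Set.iUnion_const]

theorem isRationalPolyhedralSet_univ (Γ : Set ℝ) :
    IsRationalPolyhedralSet Γ (Set.univ : Set (M →+ ℝ)) :=
  IsRationalPolyhedron.isRationalPolyhedralSet
    ⟨0, Fin.elim0, Fin.elim0, fun i => i.elim0, by ext x; simp⟩

theorem isRationalPolyhedralSet_empty (Γ : Set ℝ) :
    IsRationalPolyhedralSet Γ (∅ : Set (M →+ ℝ)) :=
  ⟨0, Fin.elim0, fun i => i.elim0, by simp⟩

theorem isRationalPolyhedralSet_biInter {Γ : Set ℝ} {ι : Type*} (s : Finset ι)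
    {U : ι → Set (M →+ ℝ)} (h : ∀ i ∈ s, IsRationalPolyhedralSet Γ (U i)) :
    IsRationalPolyhedralSet Γ (⋂ i ∈ s, U i) := by
  classical
  induction s using Finset.induction_on with
  | empty => simpa using isRationalPolyhedralSet_univ Γ
  | insert i s hi ih =>
    rw [Finset.set_biInter_insert]
    exact (polyhedralLattice Γ M).infClosed' (h i (Finset.mem_insert_self i s))
      (ih fun j hj => h j (Finset.mem_insert_of_mem hj))

theorem isRationalPolyhedralSet_biUnion {Γ : Set ℝ} {ι : Type*} (s : Finset ι)
    {U : ι → Set (M →+ ℝ)} (h : ∀ i ∈ s, IsRationalPolyhedralSet Γ (U i)) :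
    IsRationalPolyhedralSet Γ (⋃ i ∈ s, U i) := by
  classical
  induction s using Finset.induction_on with
  | empty => simpa using isRationalPolyhedralSet_empty Γ
  | insert i s hi ih =>
    rw [Finset.set_biUnion_insert]
    exact (polyhedralLattice Γ M).supClosed' (h i (Finset.mem_insert_self i s))
      (ih fun j hj => h j (Finset.mem_insert_of_mem hj))

theorem exists_mul_logT (hS : IsSubsemifield S) {a : S} (ha : a ≠ 0) :
    ∃ (γ : ℝ) (b : S), a * b = 1 ∧ logT a = (γ : WithBot ℝ) ∧ logT b = ((-γ : ℝ) : WithBot ℝ) := by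
  obtain ⟨b, hb⟩ := hS.exists_mul_eq_one ha
  have hmul := congrArg (fun a : S => logT a) hb
  simp only [Subsemiring.coe_mul, logT_mul, Subsemiring.coe_one, logT_one] at hmul
  obtain ⟨γ, hγ⟩ := exists_logT_eq (a := (a : MaxPlus)) (by simpa using ha)
  obtain ⟨δ, hδ⟩ := exists_logT_eq (a := (b : MaxPlus)) (by
    intro h0
    rw [h0] at hmul
    simp at hmul)
  refine ⟨γ, b, hb, hγ, ?_⟩
  rw [hγ, hδ] at hmul
  have : γ + δ = 0 := by exact_mod_cast hmul
  rw [hδ, eq_neg_of_add_eq_zero_right this]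

/-- The set where one term is at most another term is a half-space. -/
theorem isRationalPolyhedron_single_le (hS : IsSubsemifield S) (u v : M) {a b : S} (ha : a ≠ 0)
    (hb : b ≠ 0) :
    IsRationalPolyhedron (valueGroup S) {x | evalAt (single u a) x ≤ evalAt (single v b) x} := by
  obtain ⟨γ, a', ha', hγ, hγ'⟩ := exists_mul_logT hS ha
  obtain ⟨δ, b', hb', hδ, hδ'⟩ := exists_mul_logT hS hb
  refine ⟨1, fun _ => u - v, fun _ => δ - γ, fun _ => ⟨(b * a' : S), (b * a' : S).2, ?_⟩, ?_⟩
  · rw [Subsemiring.coe_mul, logT_mul, hδ, hγ', ← WithBot.coe_add, sub_eq_add_neg]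
  · ext x
    simp only [Set.mem_ofPred_eq, evalAt_single, hγ, hδ, ← WithBot.coe_add, WithBot.coe_le_coe,
      forall_const, map_sub]
    constructor <;> intro h <;> linarith

/-- The set where one element of `S[M]` is at most another one is polyhedral. -/
theorem isRationalPolyhedralSet_le (hS : IsSubsemifield S) (f g : AddMonoidAlgebra S M) :
    IsRationalPolyhedralSet (valueGroup S) {x | evalAt f x ≤ evalAt g x} := by
  have h : {x | evalAt f x ≤ evalAt g x} = ⋂ u ∈ f.coeff.support, ⋃ v ∈ g.coeff.support,
      {x | evalAt (single u (f.coeff u)) x ≤ evalAt (single v (g.coeff v)) x} := by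
    ext x
    rw [Set.mem_ofPred_eq, evalAt_le_iff]
    simp only [Set.mem_iInter, Set.mem_iUnion, Set.mem_ofPred_eq, exists_prop]
    refine forall₂_congr fun u hu => le_evalAt_iff ?_
    rw [Ne, evalAt_eq_bot, AddMonoidAlgebra.single_eq_zero]
    exact Finsupp.mem_support_iff.1 hu
  rw [h]
  exact isRationalPolyhedralSet_biInter _ fun u hu => isRationalPolyhedralSet_biUnion _
    fun v hv => (isRationalPolyhedron_single_le hS u v (Finsupp.mem_support_iff.1 hu)
      (Finsupp.mem_support_iff.1 hv)).isRationalPolyhedralSet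

/-- The set where `f` is at most `g`, as an element of the lattice of polyhedral sets. -/
def leSet (hS : IsSubsemifield S) (f g : AddMonoidAlgebra S M) :
    polyhedralLattice (valueGroup S) M :=
  ⟨{x | evalAt f x ≤ evalAt g x}, isRationalPolyhedralSet_le hS f g⟩

theorem evalAt_one (x : M →+ ℝ) : evalAt (1 : AddMonoidAlgebra S M) x = 0 := by
  rw [← logT_evalHom, map_one, logT_one]

/-- A polyhedron is a rational set `R(1, f₁, …, f_q)`. -/
theorem IsRationalPolyhedron.exists_eq_rationalSet (hS : IsSubsemifield S) {Q : Set (M →+ ℝ)}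
    (h : IsRationalPolyhedron (valueGroup S) Q) :
    ∃ (q : ℕ) (f : Fin q → AddMonoidAlgebra S M), Q = rationalSet 1 f := by
  obtain ⟨q, u, γ, hγ, rfl⟩ := h
  have H : ∀ i, ∃ b : S, logT b = ((-γ i : ℝ) : WithBot ℝ) := by
    intro i
    obtain ⟨a, ha, hlog⟩ := hγ i
    obtain ⟨γ', b, -, h1, h2⟩ := exists_mul_logT hS (a := ⟨a, ha⟩) (by
      intro h0
      have h1 : a = 0 := congrArg Subtype.val h0
      rw [h1] at hlog
      simp at hlog)
    obtain rfl : γ' = γ i := by exact_mod_cast h1.symm.trans hlog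
    exact ⟨b, h2⟩
  choose b hb using H
  refine ⟨q, fun i => single (u i) (b i), ?_⟩
  ext x
  simp only [rationalSet, Set.mem_ofPred_eq, evalAt_single, hb, evalAt_one]
  refine forall_congr' fun i => ?_
  rw [← WithBot.coe_add, ← WithBot.coe_zero, WithBot.coe_le_coe]
  constructor <;> intro h <;> linarith

/-! ### The filter of a prime congruence -/

section FilterOf

variable {P : RingCon (AddMonoidAlgebra S M)}

theorem leSet_mem_filterOf (hS : IsSubsemifield S) {f g : AddMonoidAlgebra S M}
    (h : CanonLE (P.mk' f) (P.mk' g)) : leSet hS f g ∈ filterOf P :=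
  ⟨g, 1, fun _ => f, fun _ hx => hx 0, fun _ => canonLE_residueMap.2 h⟩

theorem filterOf_mono {U V : polyhedralLattice (valueGroup S) M} (hU : U ∈ filterOf P)
    (hUV : U ≤ V) : V ∈ filterOf P := by
  obtain ⟨f₀, n, f, hR, hf⟩ := hU
  exact ⟨f₀, n, f, hR.trans hUV, hf⟩

theorem rationalSet_subset_mem_filterOf {U : polyhedralLattice (valueGroup S) M}
    {f₀ : AddMonoidAlgebra S M} {n : ℕ} {f : Fin n → AddMonoidAlgebra S M}
    (hR : rationalSet f₀ f ⊆ (U : Set (M →+ ℝ)))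
    (hf : ∀ i, CanonLE (P.mk' (f i)) (P.mk' f₀)) : U ∈ filterOf P :=
  ⟨f₀, n, f, hR, fun i => canonLE_residueMap.2 (hf i)⟩

namespace IsPrimeCongruence

/-- For nonzero `f₀` and `g₀` the two rational sets intersect in `R(f₀g₀, f_i g₀, f₀ g_j)`, because
finite values can be cancelled. If `f₀ = 0`, all `f_i` vanish and `R` is the whole space, so the
other set alone suffices; likewise for `g₀`. -/
theorem filterOf_inf (hP : IsPrimeCongruence P) (hS : IsSubsemifield S)
    {U V : polyhedralLattice (valueGroup S) M} (hU : U ∈ filterOf P) (hV : V ∈ filterOf P) :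
    U ⊓ V ∈ filterOf P := by
  obtain ⟨f₀, n, f, hR, hf⟩ := hU
  obtain ⟨g₀, m, g, hR', hg⟩ := hV
  simp only [canonLE_residueMap] at hf hg
  rcases eq_or_ne f₀ 0 with rfl | hf₀
  · refine ⟨g₀, m, g, fun x hx => ⟨hR fun i => ?_, hR' hx⟩, fun i => canonLE_residueMap.2 (hg i)⟩
    have : f i = 0 := by
      have h := hf i
      rw [map_zero] at h
      exact (hP.mk_eq_zero_iff hS).1
        (CanonLE.antisymm (A := P.Quotient) h (zero_canonLE (P.mk' (f i))))
    rw [this]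
  rcases eq_or_ne g₀ 0 with rfl | hg₀
  · refine ⟨f₀, n, f, fun x hx => ⟨hR hx, hR' fun i => ?_⟩, fun i => canonLE_residueMap.2 (hf i)⟩
    have : g i = 0 := by
      have h := hg i
      rw [map_zero] at h
      exact (hP.mk_eq_zero_iff hS).1
        (CanonLE.antisymm (A := P.Quotient) h (zero_canonLE (P.mk' (g i))))
    rw [this]
  refine rationalSet_subset_mem_filterOf (f₀ := f₀ * g₀)
    (f := Fin.append (fun i => f i * g₀) fun i => f₀ * g i) (fun x hx => ?_) fun i => ?_
  · refine ⟨hR fun i => ?_, hR' fun i => ?_⟩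
    · have h := hx (Fin.castAdd m i)
      rw [Fin.append_left, ← canonLE_evalHom, map_mul, map_mul, mul_comm, mul_comm _ (evalHom x g₀)]
        at h
      exact canonLE_evalHom.1 (canonLE_of_mul_left (evalHom_ne_zero hg₀) h)
    · have h := hx (Fin.natAdd n i)
      rw [Fin.append_right, ← canonLE_evalHom, map_mul, map_mul] at h
      exact canonLE_evalHom.1 (canonLE_of_mul_left (evalHom_ne_zero hf₀) h)
  · refine Fin.addCases (fun i => ?_) (fun i => ?_) i
    · rw [Fin.append_left, map_mul, map_mul]
      exact CanonLE.mul (A := P.Quotient) (hf i) (hP.canonLE_refl (P.mk' g₀))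
    · rw [Fin.append_right, map_mul, map_mul]
      exact CanonLE.mul_left (A := P.Quotient) (hg i) (P.mk' f₀)

/-- The filter of a prime congruence. -/
def toPFilter (hP : IsPrimeCongruence P) (hS : IsSubsemifield S) :
    PFilter (polyhedralLattice (valueGroup S) M) :=
  IsPFilter.toPFilter (F := filterOf P) <| IsPFilter.of_def
    ⟨leSet hS 0 0, leSet_mem_filterOf hS (hP.canonLE_refl _)⟩
    (fun _ hU _ hV => ⟨_, hP.filterOf_inf hS hU hV, inf_le_left, inf_le_right⟩)
    fun h hU => filterOf_mono hU h

variable [Module.Free ℤ M] [Module.Finite ℤ M]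

/-- Finitely many order relations can be tested at a point of any member of the filter. -/
theorem exists_point_mem (hP : IsPrimeCongruence P) (hS : IsSubsemifield S)
    (hinj : Injective (baseToResidue P)) {U : polyhedralLattice (valueGroup S) M}
    (hU : U ∈ filterOf P) (s : Finset (AddMonoidAlgebra S M)) :
    ∃ x ∈ (U : Set (M →+ ℝ)), ∀ f ∈ s, ∀ g ∈ s,
      (CanonLE (P.mk' f) (P.mk' g) ↔ evalAt f x ≤ evalAt g x) := by
  classical
  obtain ⟨f₀, n, f, hR, hf⟩ := hU
  -- Including `f₀` and the `f i` among the tested elements forces the point into the rational set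
  -- inside `U`.
  obtain ⟨x, hx⟩ := hP.exists_point hS hinj (s ∪ insert f₀ (Finset.univ.image f))
  refine ⟨x, hR fun i => ?_, fun f hf g hg =>
    hx f (Finset.mem_union_left _ hf) g (Finset.mem_union_left _ hg)⟩
  exact (hx (f i) (by simp) f₀ (by simp)).1 (canonLE_residueMap.1 (hf i))

/-- This recovers `P` from its filter. For the converse, a test point for `f` and `g` is chosen
inside the set `{f ≤ g}` itself. -/
theorem canonLE_iff_leSet_mem (hP : IsPrimeCongruence P) (hS : IsSubsemifield S)
    (hinj : Injective (baseToResidue P)) {f g : AddMonoidAlgebra S M} :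
    CanonLE (P.mk' f) (P.mk' g) ↔ leSet hS f g ∈ filterOf P := by
  classical
  refine ⟨leSet_mem_filterOf hS, fun h => ?_⟩
  obtain ⟨x, hxU, hx⟩ := hP.exists_point_mem hS hinj h {f, g}
  exact (hx f (by simp) g (by simp)).2 hxU

theorem filterOf_injective {P' : RingCon (AddMonoidAlgebra S M)} (hP : IsPrimeCongruence P)
    (hP' : IsPrimeCongruence P') (hS : IsSubsemifield S) (hinj : Injective (baseToResidue P))
    (hinj' : Injective (baseToResidue P')) (h : filterOf P = filterOf P') : P = P' := by
  have H : ∀ f g, CanonLE (P.mk' f) (P.mk' g) ↔ CanonLE (P'.mk' f) (P'.mk' g) := fun f g => by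
    rw [hP.canonLE_iff_leSet_mem hS hinj, hP'.canonLE_iff_leSet_mem hS hinj', h]
  ext f g
  rw [← mk_eq_mk_iff, ← mk_eq_mk_iff]
  constructor
  · intro hfg
    exact CanonLE.antisymm (A := P'.Quotient) ((H f g).1 (hfg ▸ hP.canonLE_refl _))
      ((H g f).1 (hfg ▸ hP.canonLE_refl _))
  · intro hfg
    exact CanonLE.antisymm (A := P.Quotient) ((H f g).2 (hfg ▸ hP'.canonLE_refl _))
      ((H g f).2 (hfg ▸ hP'.canonLE_refl _))

/-- A point of the union that tests all defining inequalities lies in one of the polyhedra. The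
inequalities of that polyhedron then hold modulo `P`, so the set containing it belongs to the
filter. -/
theorem filterOf_prime (hP : IsPrimeCongruence P) (hS : IsSubsemifield S)
    (hinj : Injective (baseToResidue P)) {U V : polyhedralLattice (valueGroup S) M}
    (h : U ⊔ V ∈ filterOf P) : U ∈ filterOf P ∨ V ∈ filterOf P := by
  classical
  obtain ⟨U, m, Q, hQ, rfl⟩ := U
  obtain ⟨V, m', Q', hQ', rfl⟩ := V
  choose q f hf using fun j => (hQ j).exists_eq_rationalSet hS
  choose q' f' hf' using fun j => (hQ' j).exists_eq_rationalSet hS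
  obtain ⟨x, hxU, hx⟩ := hP.exists_point_mem hS hinj h
    (insert 1 ((Finset.univ.image fun p : (j : Fin m) × Fin (q j) => f p.1 p.2) ∪
      Finset.univ.image fun p : (j : Fin m') × Fin (q' j) => f' p.1 p.2))
  rcases hxU with hxU | hxU
  · left
    obtain ⟨j, hj⟩ := Set.mem_iUnion.1 hxU
    rw [hf j] at hj
    refine rationalSet_subset_mem_filterOf (f₀ := 1) (f := f j) ?_ fun i => ?_
    · rw [← hf j]
      exact Set.subset_iUnion Q j
    · exact (hx (f j i) (Finset.mem_insert_of_mem (Finset.mem_union_left _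
        (Finset.mem_image.2 ⟨⟨j, i⟩, Finset.mem_univ _, rfl⟩))) 1 (by simp)).2 (hj i)
  · right
    obtain ⟨j, hj⟩ := Set.mem_iUnion.1 hxU
    rw [hf' j] at hj
    refine rationalSet_subset_mem_filterOf (f₀ := 1) (f := f' j) ?_ fun i => ?_
    · rw [← hf' j]
      exact Set.subset_iUnion Q' j
    · exact (hx (f' j i) (Finset.mem_insert_of_mem (Finset.mem_union_right _
        (Finset.mem_image.2 ⟨⟨j, i⟩, Finset.mem_univ _, rfl⟩))) 1 (by simp)).2 (hj i)

theorem isPrime_toPFilter (hP : IsPrimeCongruence P) (hS : IsSubsemifield S)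
    (hinj : Injective (baseToResidue P)) : (hP.toPFilter hS).IsPrime := by
  refine ⟨fun U V hVU hU hV => hU (filterOf_mono hV hVU), ⟨⟨∅, isRationalPolyhedralSet_empty _⟩,
    fun h => ?_⟩, fun U hU V hV => ⟨U ⊔ V, fun h => ?_, le_sup_left, le_sup_right⟩⟩
  -- Even with nothing to compare, the test point shows that a member of the filter is nonempty.
  · obtain ⟨x, hx, -⟩ := hP.exists_point_mem hS hinj h ∅
    exact hx
  · exact (hP.filterOf_prime hS hinj h).elim hU hV

end IsPrimeCongruence

end FilterOf

/-! ### The prime congruence of a prime filter -/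

section OfFilter

variable {F : PFilter (polyhedralLattice (valueGroup S) M)}

/-- The congruence which identifies two elements of `S[M]` if their values agree on a member of the
filter `F`. -/
def congruenceOf (F : PFilter (polyhedralLattice (valueGroup S) M)) :
    RingCon (AddMonoidAlgebra S M) where
  r f g := ∃ U ∈ F, ∀ x ∈ (U : Set (M →+ ℝ)), evalHom x f = evalHom x g
  iseqv :=
    { refl := fun f => by
        obtain ⟨U, hU⟩ := F.nonempty
        exact ⟨U, hU, fun _ _ => rfl⟩
      symm := fun ⟨U, hU, h⟩ => ⟨U, hU, fun x hx => (h x hx).symm⟩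
      trans := fun ⟨U, hU, h⟩ ⟨V, hV, h'⟩ =>
        ⟨U ⊓ V, PFilter.inf_mem hU hV, fun x hx => (h x hx.1).trans (h' x hx.2)⟩ }
  add' := fun ⟨U, hU, h⟩ ⟨V, hV, h'⟩ => ⟨U ⊓ V, PFilter.inf_mem hU hV, fun x hx => by
    rw [map_add, map_add, h x hx.1, h' x hx.2]⟩
  mul' := fun ⟨U, hU, h⟩ ⟨V, hV, h'⟩ => ⟨U ⊓ V, PFilter.inf_mem hU hV, fun x hx => by
    rw [map_mul, map_mul, h x hx.1, h' x hx.2]⟩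

theorem congruenceOf_mk_eq_iff {f g : AddMonoidAlgebra S M} :
    (congruenceOf F).mk' f = (congruenceOf F).mk' g ↔
      ∃ U ∈ F, ∀ x ∈ (U : Set (M →+ ℝ)), evalHom x f = evalHom x g :=
  mk_eq_mk_iff

/-- The relation `f + g ≡ g` asks for a member of `F` on which `f ≤ g`, and `{f ≤ g}` is the largest
candidate. -/
theorem congruenceOf_canonLE_iff (hS : IsSubsemifield S) {f g : AddMonoidAlgebra S M} :
    CanonLE ((congruenceOf F).mk' f) ((congruenceOf F).mk' g) ↔ leSet hS f g ∈ F := by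
  have h : CanonLE ((congruenceOf F).mk' f) ((congruenceOf F).mk' g) ↔
      (congruenceOf F).mk' (f + g) = (congruenceOf F).mk' g := by
    rw [map_add]
    rfl
  rw [h, congruenceOf_mk_eq_iff]
  constructor
  · rintro ⟨U, hU, hx⟩
    refine F.mem_of_le (fun x hxU => ?_) hU
    have := hx x hxU
    rw [map_add] at this
    exact canonLE_evalHom.1 this
  · intro h
    refine ⟨_, h, fun x hx => ?_⟩
    rw [map_add]
    exact canonLE_evalHom.2 hx

theorem sup_mem_of_isPrime (hF : F.IsPrime) {U V : polyhedralLattice (valueGroup S) M}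
    (h : U ⊔ V ∈ F) : U ∈ F ∨ V ∈ F := by
  by_contra! hn
  obtain ⟨W, hW, hU, hV⟩ := hF.compl_ideal.Directed U hn.1 V hn.2
  exact hW (F.mem_of_le (sup_le hU hV) h)

theorem nonempty_of_mem_of_isPrime (hF : F.IsPrime) {U : polyhedralLattice (valueGroup S) M}
    (h : U ∈ F) : (U : Set (M →+ ℝ)).Nonempty := by
  by_contra hn
  obtain ⟨V, hV⟩ := hF.compl_ideal.Nonempty
  refine hV (F.mem_of_le (fun x hx => ?_) h)
  exact absurd ⟨x, hx⟩ hn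

/-- A member of a prime filter contains a polyhedron which is a member. -/
theorem exists_polyhedron_mem (hF : F.IsPrime) {U : polyhedralLattice (valueGroup S) M}
    (hU : U ∈ F) : ∃ V ∈ F, V ≤ U ∧ IsRationalPolyhedron (valueGroup S) (V : Set (M →+ ℝ)) := by
  obtain ⟨_, m, Q, hQ, rfl⟩ := U
  induction m with
  | zero =>
    obtain ⟨x, hx⟩ := nonempty_of_mem_of_isPrime hF hU
    obtain ⟨i, -⟩ := Set.mem_iUnion.1 hx
    exact i.elim0
  | succ m ih =>
    let V : polyhedralLattice (valueGroup S) M := ⟨Q 0, (hQ 0).isRationalPolyhedralSet⟩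
    let W : polyhedralLattice (valueGroup S) M :=
      ⟨⋃ j : Fin m, Q j.succ, m, fun j => Q j.succ, fun j => hQ j.succ, rfl⟩
    have hVW : V ⊔ W ∈ F := by
      refine F.mem_of_le (fun x hx => ?_) hU
      obtain ⟨j, hj⟩ := Set.mem_iUnion.1 hx
      revert hj
      refine Fin.cases (fun hj => Or.inl hj) (fun j hj => Or.inr ?_) j
      exact Set.mem_iUnion.2 ⟨j, hj⟩
    rcases sup_mem_of_isPrime hF hVW with h | h
    · exact ⟨V, h, Set.subset_iUnion Q 0, hQ 0⟩
    · obtain ⟨V', hV', hle, hpol⟩ := ih (fun j => Q j.succ) (fun j => hQ j.succ) h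
      refine ⟨V', hV', hle.trans fun x hx => ?_, hpol⟩
      obtain ⟨j, hj⟩ := Set.mem_iUnion.1 hx
      exact Set.mem_iUnion.2 ⟨j.succ, hj⟩

/-- Properness holds because `0` and `1` differ at any point of a nonempty member. Totality is
primality of `F` applied to the cover by `{f ≤ g}` and `{g ≤ f}`. Cancellation is pointwise, a
nonzero `f` having finite values everywhere. -/
theorem isPrimeCongruence_congruenceOf (hS : IsSubsemifield S) (hF : F.IsPrime) :
    IsPrimeCongruence (congruenceOf F) where
  proper h := by
    have h' : (congruenceOf F) 1 0 := by
      rw [h]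
      trivial
    obtain ⟨U, hU, hx⟩ := h'
    obtain ⟨x, hxU⟩ := nonempty_of_mem_of_isPrime hF hU
    simpa using hx x hxU
  total a b := by
    obtain ⟨f, rfl⟩ := (congruenceOf F).mk'_surjective a
    obtain ⟨g, rfl⟩ := (congruenceOf F).mk'_surjective b
    rw [congruenceOf_canonLE_iff hS, congruenceOf_canonLE_iff hS]
    obtain ⟨U, hU⟩ := F.nonempty
    exact sup_mem_of_isPrime hF (F.mem_of_le (fun x _ => le_total (evalAt f x) (evalAt g x)) hU)
  cancel a b c ha h := by
    obtain ⟨f, rfl⟩ := (congruenceOf F).mk'_surjective a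
    obtain ⟨g, rfl⟩ := (congruenceOf F).mk'_surjective b
    obtain ⟨k, rfl⟩ := (congruenceOf F).mk'_surjective c
    have hf : f ≠ 0 := by
      rintro rfl
      exact ha (map_zero _)
    have h' : (congruenceOf F).mk' (f * g) = (congruenceOf F).mk' (f * k) := by
      rw [map_mul, map_mul]
      exact h
    obtain ⟨U, hU, hx⟩ := congruenceOf_mk_eq_iff.1 h'
    refine congruenceOf_mk_eq_iff.2 ⟨U, hU, fun x hxU => ?_⟩
    have hxe := hx x hxU
    rw [map_mul, map_mul] at hxe
    have hrefl : ∀ a : MaxPlus, CanonLE a a := Tropical.add_self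
    refine CanonLE.antisymm (canonLE_of_mul_left (evalHom_ne_zero (x := x) hf) ?_)
      (canonLE_of_mul_left (evalHom_ne_zero (x := x) hf) ?_)
    · rw [hxe]
      exact hrefl _
    · rw [hxe]
      exact hrefl _

theorem baseToResidue_congruenceOf_injective (hF : F.IsPrime) :
    Injective (baseToResidue (congruenceOf F)) := by
  intro a b h
  obtain ⟨U, hU, hx⟩ := congruenceOf_mk_eq_iff.1 (residueMap_eq_iff.1 h)
  obtain ⟨x, hxU⟩ := nonempty_of_mem_of_isPrime hF hU
  have h : evalHom x (single (0 : M) a) = evalHom x (single (0 : M) b) := hx x hxU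
  rw [evalHom_single, evalHom_single, map_zero, expT_zero, mul_one, mul_one] at h
  exact Subtype.ext h

/-- A rational set defined by relations modulo the congruence contains a finite intersection of
members of `F`. Conversely, a member of `F` contains a polyhedron in `F`, which has the form `R(1,
f₁, …, f_q)`. -/
theorem filterOf_congruenceOf (hS : IsSubsemifield S) (hF : F.IsPrime) :
    filterOf (congruenceOf F) = F := by
  ext U
  constructor
  · rintro ⟨f₀, n, f, hR, hf⟩
    simp only [canonLE_residueMap, congruenceOf_canonLE_iff hS] at hf
    have H : ∀ s : Finset (Fin n), ∃ V ∈ F, ∀ x ∈ (V : Set (M →+ ℝ)), ∀ i ∈ s,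
        evalAt (f i) x ≤ evalAt f₀ x := by
      intro s
      induction s using Finset.induction_on with
      | empty =>
        obtain ⟨V, hV⟩ := F.nonempty
        exact ⟨V, hV, by simp⟩
      | insert i s hi ih =>
        obtain ⟨V, hV, h⟩ := ih
        refine ⟨V ⊓ leSet hS (f i) f₀, PFilter.inf_mem hV (hf i), fun x hx j hj => ?_⟩
        rcases Finset.mem_insert.1 hj with rfl | hj
        · exact hx.2
        · exact h x hx.1 j hj
    obtain ⟨V, hV, h⟩ := H Finset.univ
    exact F.mem_of_le (fun x hx => hR fun i => h x hx i (Finset.mem_univ i)) hV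
  · intro hU
    obtain ⟨V, hV, hVU, hpol⟩ := exists_polyhedron_mem hF hU
    obtain ⟨q, f, hf⟩ := hpol.exists_eq_rationalSet hS
    refine rationalSet_subset_mem_filterOf (f₀ := 1) (f := f) (hf ▸ hVU) fun i => ?_
    rw [congruenceOf_canonLE_iff hS]
    refine F.mem_of_le (fun x hx => ?_) hV
    rw [hf] at hx
    exact hx i

end OfFilter

/-! ### Continuity -/

section Continuity

theorem CanonLT.trans_le {A : Type*} [CommSemiring A] {a b c : A} (h : CanonLT a b)
    (h' : CanonLE b c) : CanonLT a c := by
  refine ⟨h.1.trans h', ?_⟩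
  rintro rfl
  exact h.2 (h.1.antisymm h')

theorem CanonLE.trans_lt {A : Type*} [CommSemiring A] {a b c : A} (h : CanonLE a b)
    (h' : CanonLT b c) : CanonLT a c := by
  refine ⟨h.trans h'.1, ?_⟩
  rintro rfl
  exact h'.2 (h'.1.antisymm h)

theorem isOpen_canonTopology {K : Type*} [CommSemiring K] {U : Set K}
    (h : 0 ∉ U ∨ ∃ c : K, c ≠ 0 ∧ {x | CanonLT x c} ⊆ U) : @IsOpen K (canonTopology K) U := by
  let _ := canonTopology K
  have hsing : ∀ c : K, c ≠ 0 → IsOpen ({c} : Set K) := fun c hc =>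
    TopologicalSpace.GenerateOpen.basic _ (Or.inl ⟨c, hc, rfl⟩)
  have hU : IsOpen (⋃ c ∈ {c | c ∈ U ∧ c ≠ 0}, ({c} : Set K)) :=
    isOpen_biUnion fun c hc => hsing c hc.2
  rw [Set.biUnion_of_singleton] at hU
  rcases h with h | ⟨c, hc, h⟩
  · convert hU using 1
    ext x
    exact ⟨fun hx => ⟨hx, fun h0 => h (h0 ▸ hx)⟩, fun hx => hx.1⟩
  · have hc' : IsOpen {x : K | CanonLT x c} :=
      TopologicalSpace.GenerateOpen.basic _ (Or.inr ⟨c, hc, rfl⟩)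
    convert hc'.union hU using 1
    ext x
    constructor
    · intro hx
      rcases eq_or_ne x 0 with rfl | h0
      · exact Or.inl ⟨zero_canonLE c, hc.symm⟩
      · exact Or.inr ⟨hx, h0⟩
    · rintro (hx | hx)
      · exact h hx
      · exact hx.1

/-- Induction over the generated topology; totality serves to pick the smaller of two bounds for an
intersection. -/
theorem exists_canonLT_subset_of_isOpen {K : Type*} [CommSemiring K] [Nontrivial K]
    (hK : ∀ a b : K, CanonLE a b ∨ CanonLE b a) {U : Set K} (hU : @IsOpen K (canonTopology K) U)
    (h0 : 0 ∈ U) : ∃ c : K, c ≠ 0 ∧ {x | CanonLT x c} ⊆ U := by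
  induction hU with
  | basic V hV =>
    rcases hV with ⟨c, hc, rfl⟩ | ⟨c, hc, rfl⟩
    · exact absurd h0.symm hc
    · exact ⟨c, hc, subset_rfl⟩
  | univ => exact ⟨1, one_ne_zero, Set.subset_univ _⟩
  | inter V W _ _ ihV ihW =>
    obtain ⟨c, hc, hcV⟩ := ihV h0.1
    obtain ⟨d, hd, hdW⟩ := ihW h0.2
    rcases hK c d with h | h
    · exact ⟨c, hc, fun x hx => ⟨hcV hx, hdW (hx.trans_le h)⟩⟩
    · exact ⟨d, hd, fun x hx => ⟨hcV (hx.trans_le h), hdW hx⟩⟩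
  | sUnion T _ ih =>
    obtain ⟨V, hV, h0V⟩ := h0
    obtain ⟨c, hc, h⟩ := ih V hV h0V
    exact ⟨c, hc, h.trans (Set.subset_sUnion_of_mem hV)⟩

theorem exists_logT_pow_le {d : S} {γ : ℝ} (hd : logT d = (γ : WithBot ℝ)) (hγ : γ < 0) (B : ℝ) :
    ∃ n : ℕ, logT ((d ^ n : S) : MaxPlus) ≤ (B : WithBot ℝ) := by
  have h : ∀ n : ℕ, logT ((d ^ n : S) : MaxPlus) = ((n * γ : ℝ) : WithBot ℝ) := by
    intro n
    induction n with
    | zero => simp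
    | succ n ih =>
      rw [pow_succ, Subsemiring.coe_mul, logT_mul, ih, hd, ← WithBot.coe_add]
      rw [Nat.cast_succ, add_one_mul]
  obtain ⟨n, hn⟩ := exists_nat_ge (B / γ)
  refine ⟨n, ?_⟩
  rw [h, WithBot.coe_le_coe]
  rwa [div_le_iff_of_neg hγ] at hn

/-- Since `S` is not Boolean, some element or its inverse has negative logarithm, and the logarithms
of its powers tend to `-∞`. -/
theorem exists_logT_le (hS : IsSubsemifield S) (B : ℝ) :
    ∃ a : S, a ≠ 0 ∧ logT a ≤ (B : WithBot ℝ) := by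
  have H : ∃ (d : S) (γ : ℝ), logT d = (γ : WithBot ℝ) ∧ γ < 0 := by
    obtain ⟨a, haS, ha0, ha1⟩ := hS.not_boolean
    obtain ⟨γ, b, -, h1, h2⟩ := exists_mul_logT hS (a := ⟨a, haS⟩) (by
      intro h
      exact ha0 (congrArg Subtype.val h))
    rcases lt_trichotomy γ 0 with h | rfl | h
    · exact ⟨_, γ, h1, h⟩
    · exact absurd (logT_injective h1) ha1
    · exact ⟨b, -γ, h2, neg_neg_of_pos h⟩
  obtain ⟨d, γ, hd, hγ⟩ := H
  obtain ⟨n, hn⟩ := exists_logT_pow_le hd hγ B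
  refine ⟨d ^ n, fun h0 => ?_, hn⟩
  obtain ⟨e, he⟩ := hS.exists_mul_eq_one (a := d) (by
    rintro rfl
    simp at hd)
  have h := congrArg (· * e ^ n) h0
  simp only [← mul_pow, he, one_pow, zero_mul] at h
  exact absurd (congrArg (fun a : S => logT a) h) (by simp)

/-- A finite `S` would have a smallest nonzero element. -/
theorem infinite_of_isSubsemifield (hS : IsSubsemifield S) : Infinite S := by
  by_contra h
  rw [not_infinite_iff_finite] at h
  have := Fintype.ofFinite S
  obtain ⟨a, ha, hmin⟩ := (Set.toFinite {a : S | a ≠ 0}).exists_minimalFor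
    (fun a : S => logT a) _ ⟨1, fun h => by simpa using congrArg (fun a : S => logT a) h⟩
  obtain ⟨γ, hγ⟩ := exists_logT_eq (a := (a : MaxPlus)) (by simpa using ha)
  obtain ⟨b, hb, hle⟩ := exists_logT_le hS (γ - 1)
  have hlt : logT (b : MaxPlus) < logT a := by
    rw [hγ]
    refine hle.trans_lt (WithBot.coe_lt_coe.2 (by linarith))
  exact absurd (hmin hb hlt.le) hlt.not_ge

end Continuity

/-! ### Continuous prime congruences and polytopes -/

theorem exists_baseToResidue_canonLT {P : RingCon (AddMonoidAlgebra S M)}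
    (hc : @Continuous S (ResidueSemifield P) (canonTopology S)
      (canonTopology (ResidueSemifield P)) (baseToResidue P)) {z : ResidueSemifield P}
    (hz : z ≠ 0) : ∃ a : S, a ≠ 0 ∧ ∀ b : S, CanonLT b a → CanonLT (baseToResidue P b) z := by
  have hopen : @IsOpen S (canonTopology S) (baseToResidue P ⁻¹' {x | CanonLT x z}) :=
    continuous_generateFrom_iff.1 hc _ (Or.inr ⟨z, hz, rfl⟩)
  have h0 : (0 : S) ∈ baseToResidue P ⁻¹' {x | CanonLT x z} := by
    rw [Set.mem_preimage, map_zero]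
    exact ⟨zero_canonLE z, hz.symm⟩
  have : Nontrivial S := ⟨⟨1, 0, fun h => by simpa using congrArg (fun a : S => logT a) h⟩⟩
  obtain ⟨a, ha, h⟩ := exists_canonLT_subset_of_isOpen canonLE_total hopen h0
  exact ⟨a, ha, fun b hb => h hb⟩

theorem canonLT_of_logT_lt {a b : S} (h : logT (a : MaxPlus) < logT b) : CanonLT a b := by
  refine ⟨canonLE_coe.1 (canonLE_iff_logT.2 h.le), ?_⟩
  rintro rfl
  exact h.false

namespace IsPrimeCongruence

variable {P : RingCon (AddMonoidAlgebra S M)}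

/-- A denominator has the class of a unit term, so it is already invertible in the quotient. -/
theorem residueMap_surjective (hP : IsPrimeCongruence P) (hS : IsSubsemifield S) :
    Surjective (residueMap P) := by
  intro z
  obtain ⟨⟨p, s⟩, hz⟩ := IsLocalization.surj (cancellatives P.Quotient) z
  obtain ⟨f, rfl⟩ := P.mk'_surjective p
  obtain ⟨g, hg⟩ := P.mk'_surjective (s : P.Quotient)
  have hg0 : g ≠ 0 := by
    rintro rfl
    rw [map_zero] at hg
    exact hP.one_ne_zero (s.2 1 0 (by rw [← hg, zero_mul, zero_mul]))
  obtain ⟨u, hu, hgu⟩ := hP.exists_mk_eq_mk_single hg0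
  obtain ⟨b, hb⟩ := hS.exists_mul_eq_one (Finsupp.mem_support_iff.1 hu)
  refine ⟨f * single (-u) b, ?_⟩
  have h1 : P.mk' (g * single (-u) b) = 1 := by
    rw [map_mul, hgu, ← map_mul, AddMonoidAlgebra.single_mul_single, hb, add_neg_cancel,
      ← AddMonoidAlgebra.one_def, map_one]
  have hz' : z * residueMap P g = residueMap P f := by
    rw [← hg] at hz
    exact hz
  rw [map_mul, ← hz', mul_assoc, ← map_mul]
  have h2 : residueMap P (g * single (-u) b) = 1 := by
    rw [← map_one (residueMap P), residueMap_eq_iff, h1, map_one]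
  rw [h2, mul_one]

theorem residueMap_single_ne_zero (hP : IsPrimeCongruence P) (hS : IsSubsemifield S) (u : M) {a : S}
    (ha : a ≠ 0) : residueMap P (single u a) ≠ 0 := by
  rw [← map_zero (residueMap P), Ne, residueMap_eq_iff, map_zero]
  exact hP.mk_single_ne_zero hS u ha

/-- If `b < c` had the same image, the quotient `b/c` would map to `1` and have negative logarithm.
Its powers become arbitrarily small in `S` but keep the image `1`, so they never enter the
neighbourhood `{x | x < 1}` of `0`. -/
theorem baseToResidue_injective_of_continuous (hP : IsPrimeCongruence P) (hS : IsSubsemifield S)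
    (hc : @Continuous S (ResidueSemifield P) (canonTopology S)
      (canonTopology (ResidueSemifield P)) (baseToResidue P)) :
    Injective (baseToResidue P) := by
  have hne : ∀ {a : S}, a ≠ 0 → baseToResidue P a ≠ 0 := fun ha =>
    hP.residueMap_single_ne_zero hS 0 ha
  have hlt : ∀ b c : S, logT (b : MaxPlus) < logT c → baseToResidue P b ≠ baseToResidue P c := by
    intro b c hbc h
    have hc0 : c ≠ 0 := by
      rintro rfl
      simp at hbc
    have hb0 : b ≠ 0 := by
      rintro rfl
      rw [map_zero] at h
      exact hne hc0 h.symm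
    obtain ⟨β, hβ⟩ := exists_logT_eq (a := (b : MaxPlus)) (by simpa using hb0)
    obtain ⟨γ, c', hcc, hγ, hγ'⟩ := exists_mul_logT hS hc0
    rw [hβ, hγ, WithBot.coe_lt_coe] at hbc
    have hd : logT ((b * c' : S) : MaxPlus) = ((β - γ : ℝ) : WithBot ℝ) := by
      rw [Subsemiring.coe_mul, logT_mul, hβ, hγ', ← WithBot.coe_add, sub_eq_add_neg]
    have hd1 : baseToResidue P (b * c') = 1 := by
      rw [map_mul, h, ← map_mul, hcc, map_one]
    have h10 : (1 : ResidueSemifield P) ≠ 0 := by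
      rw [← map_one (baseToResidue P)]
      refine hne fun h0 => ?_
      simpa using congrArg (fun a : S => logT a) h0
    obtain ⟨a, ha, hlt⟩ := exists_baseToResidue_canonLT hc h10
    obtain ⟨α, hα⟩ := exists_logT_eq (a := (a : MaxPlus)) (by simpa using ha)
    obtain ⟨n, hn⟩ := exists_logT_pow_le hd (by linarith) (α - 1)
    have hlt' := hlt ((b * c') ^ n) (canonLT_of_logT_lt (by
      rw [hα]
      exact hn.trans_lt (WithBot.coe_lt_coe.2 (by linarith))))
    rw [map_pow, hd1, one_pow] at hlt'
    exact hlt'.2 rfl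
  intro b c h
  rcases lt_trichotomy (logT (b : MaxPlus)) (logT (c : MaxPlus)) with h' | h' | h'
  · exact absurd h (hlt b c h')
  · exact logT_coe_injective h'
  · exact absurd h.symm (hlt c b h')

theorem infinite_quotient (hS : IsSubsemifield S) (hinj : Injective (baseToResidue P)) :
    Infinite P.Quotient := by
  have := infinite_of_isSubsemifield hS
  refine Infinite.of_injective (fun a : S => P.mk' (single (0 : M) a)) fun a b h => ?_
  exact hinj (residueMap_eq_iff.2 h)

/-- If finitely many elements of `M` have values bounded above by `Γ`, so has a member of the
filter. -/
theorem exists_polyhedron_mem_filterOf {n : ℕ} (hS : IsSubsemifield S) (v : Fin n → M)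
    (h : ∀ i, ∃ a : S, a ≠ 0 ∧ CanonLE (P.mk' (single (v i) a)) 1) :
    ∃ (U : polyhedralLattice (valueGroup S) M) (γ : Fin n → ℝ), U ∈ filterOf P ∧
      IsRationalPolyhedron (valueGroup S) (U : Set (M →+ ℝ)) ∧
      (U : Set (M →+ ℝ)) = {x | ∀ i, x (v i) ≤ γ i} := by
  choose a ha hle using h
  choose γ b hab hγ hγ' using fun i => exists_mul_logT hS (ha i)
  have hQ : IsRationalPolyhedron (valueGroup S) {x : M →+ ℝ | ∀ i, x (v i) ≤ -γ i} :=
    ⟨n, v, fun i => -γ i, fun i => ⟨b i, (b i).2, hγ' i⟩, rfl⟩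
  refine ⟨⟨_, hQ.isRationalPolyhedralSet⟩, fun i => -γ i, ?_, hQ, rfl⟩
  refine rationalSet_subset_mem_filterOf (f₀ := 1) (f := fun i => single (v i) (a i))
    (fun x hx i => ?_) fun i => ?_
  · have h := hx i
    rw [evalAt_single, hγ, evalAt_one, ← WithBot.coe_add, ← WithBot.coe_zero,
      WithBot.coe_le_coe] at h
    linarith
  · rw [map_one]
    exact hle i

variable [Module.Free ℤ M] [Module.Finite ℤ M]

/-- Continuity gives a nonzero constant below `χ^(-u)`, that is, an upper bound for `χ^u` modulo
`P`. Doing this for a basis of `M` and for its negatives cuts out a box. -/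
theorem exists_polytope_mem_filterOf (hP : IsPrimeCongruence P) (hS : IsSubsemifield S)
    (hc : @Continuous S (ResidueSemifield P) (canonTopology S)
      (canonTopology (ResidueSemifield P)) (baseToResidue P)) :
    ∃ U ∈ filterOf P, IsRationalPolytope (valueGroup S) (U : Set (M →+ ℝ)) := by
  have hbd : ∀ u : M, ∃ a : S, a ≠ 0 ∧ CanonLE (P.mk' (single u a)) 1 := by
    intro u
    have h1 : (1 : S) ≠ 0 := fun h => by simpa using congrArg (fun a : S => logT a) h
    obtain ⟨a, ha, hlt⟩ :=
      exists_baseToResidue_canonLT hc (hP.residueMap_single_ne_zero hS (-u) h1)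
    obtain ⟨α, hα⟩ := exists_logT_eq (a := (a : MaxPlus)) (by simpa using ha)
    -- Subtracting `1` makes `b` strictly smaller than `a`.
    obtain ⟨b, hb, hle⟩ := exists_logT_le hS (α - 1)
    have hlt' := hlt b (canonLT_of_logT_lt (by
      rw [hα]
      exact hle.trans_lt (WithBot.coe_lt_coe.2 (by linarith))))
    have h := canonLE_residueMap.1 hlt'.1
    refine ⟨b, hb, ?_⟩
    have h' := CanonLE.mul_left (A := P.Quotient) h (P.mk' (single u 1))
    change CanonLE (P.mk' (single u 1) * P.mk' (single (0 : M) b)) _ at h'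
    rw [← map_mul, ← map_mul, AddMonoidAlgebra.single_mul_single,
      AddMonoidAlgebra.single_mul_single, add_zero, add_neg_cancel, one_mul, one_mul,
      ← AddMonoidAlgebra.one_def, map_one] at h'
    exact h'
  let e := Module.finBasis ℤ M
  obtain ⟨U, γ, hU, hUpol, hUeq⟩ :=
    exists_polyhedron_mem_filterOf (P := P) hS e fun i => hbd _
  obtain ⟨V, δ, hV, hVpol, hVeq⟩ :=
    exists_polyhedron_mem_filterOf (P := P) hS (fun i => -e i) fun i => hbd _
  refine ⟨U ⊓ V, hP.filterOf_inf hS hU hV, hUpol.inter hVpol, fun u => ?_⟩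
  refine ⟨∑ i, |(e.repr u i : ℝ)| * max (γ i) (δ i), fun x hx => ?_⟩
  have hxU : ∀ i, x (e i) ≤ γ i := by
    have h := hx.1
    rw [hUeq] at h
    exact h
  have hxV : ∀ i, x (-e i) ≤ δ i := by
    have h := hx.2
    rw [hVeq] at h
    exact h
  have hxu : x u = ∑ i, (e.repr u i : ℝ) * x (e i) := by
    conv_lhs => rw [← e.sum_repr u]
    rw [map_sum]
    exact Finset.sum_congr rfl fun i _ => by rw [map_zsmul, zsmul_eq_mul]
  rw [hxu]
  refine (Finset.abs_sum_le_sum_abs _ _).trans (Finset.sum_le_sum fun i _ => ?_)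
  rw [abs_mul]
  refine mul_le_mul_of_nonneg_left (abs_le'.2 ⟨(hxU i).trans (le_max_left _ _), ?_⟩)
    (abs_nonneg _)
  rw [← map_neg]
  exact (hxV i).trans (le_max_right _ _)

/-- Only the rays `{x | x < z}` need attention. Writing `z` as the class of some `f`, a single term
of `f` is bounded below on the polytope by a nonzero constant `a`, so `a ≤ f` modulo `P`;
injectivity keeps `b < a` strict in `κ(P)`. -/
theorem continuous_of_polytope_mem (hP : IsPrimeCongruence P) (hS : IsSubsemifield S)
    (hinj : Injective (baseToResidue P)) {U : polyhedralLattice (valueGroup S) M}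
    (hU : U ∈ filterOf P) (hpol : IsRationalPolytope (valueGroup S) (U : Set (M →+ ℝ))) :
    @Continuous S (ResidueSemifield P) (canonTopology S) (canonTopology (ResidueSemifield P))
      (baseToResidue P) := by
  refine continuous_generateFrom_iff.2 ?_
  rintro _ (⟨z, hz, rfl⟩ | ⟨z, hz, rfl⟩)
  · refine isOpen_canonTopology (Or.inl fun h => hz ?_)
    rw [Set.mem_preimage, map_zero] at h
    exact h.symm
  · obtain ⟨f, rfl⟩ := hP.residueMap_surjective hS z
    have hf : f ≠ 0 := by
      rintro rfl
      exact hz (map_zero _)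
    obtain ⟨u, hu, -⟩ := hP.exists_mk_eq_mk_single hf
    have hfu : f.coeff u ≠ 0 := Finsupp.mem_support_iff.1 hu
    obtain ⟨β, hβ⟩ := exists_logT_eq (a := (f.coeff u : MaxPlus)) (by simpa using hfu)
    obtain ⟨B, hB⟩ := hpol.2 u
    -- On `U` the chosen term of `f` has value at least `β - B`.
    obtain ⟨a, ha, hle⟩ := exists_logT_le hS (β - B)
    have haf : CanonLE (P.mk' (single (0 : M) a)) (P.mk' f) := by
      rw [hP.canonLE_iff_leSet_mem hS hinj]
      refine filterOf_mono hU fun x hx => ?_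
      have hxB := neg_le_of_abs_le (hB x hx)
      refine le_trans ?_ (evalAt_le_iff.1 le_rfl u hu)
      rw [evalAt_single, evalAt_single, map_zero, hβ, WithBot.coe_zero, add_zero,
        ← WithBot.coe_add]
      exact hle.trans (WithBot.coe_le_coe.2 (by linarith))
    refine isOpen_canonTopology (Or.inr ⟨a, ha, fun b hb => ?_⟩)
    refine CanonLT.trans_le (A := ResidueSemifield P) (b := baseToResidue P a) ⟨?_, ?_⟩
      (canonLE_residueMap.2 haf)
    · exact CanonLE.map (B := ResidueSemifield P) (baseToResidue P) hb.1
    · exact hinj.ne hb.2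

theorem mem_contSpec_iff (hP : IsPrimeCongruence P) (hS : IsSubsemifield S)
    (hinj : Injective (baseToResidue P)) :
    P ∈ contSpec S M ↔
      ∃ U ∈ filterOf P, IsRationalPolytope (valueGroup S) (U : Set (M →+ ℝ)) :=
  ⟨fun h => hP.exists_polytope_mem_filterOf hS h.2.2, fun ⟨_, hU, hpol⟩ =>
    ⟨hP, infinite_quotient hS hinj, hP.continuous_of_polytope_mem hS hinj hU hpol⟩⟩

end IsPrimeCongruence

end TropicalFilters

end

/-! ### The bijection between prime congruences and prime filters -/

theorem mainTheorem10 {M : Type*} [AddCommGroup M] [Module.Free ℤ M] [Module.Finite ℤ M]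
    (S : Subsemiring TropicalFilters.MaxPlus) (hS : TropicalFilters.IsSubsemifield S) :
    (∀ P ∈ TropicalFilters.contSpec S M, Function.Injective (TropicalFilters.baseToResidue P)) ∧
    ∃ Φ : {P : RingCon (AddMonoidAlgebra S M) //
          TropicalFilters.IsPrimeCongruence P ∧
            Function.Injective (TropicalFilters.baseToResidue P)} ≃
        {F : Order.PFilter
            (TropicalFilters.polyhedralLattice (TropicalFilters.valueGroup S) M) // F.IsPrime},
      (∀ P, ((Φ P).1 : Set (TropicalFilters.polyhedralLattice (TropicalFilters.valueGroup S) M)) =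
        TropicalFilters.filterOf P.1) ∧
      (∀ P, P.1 ∈ TropicalFilters.contSpec S M ↔
        ∃ U ∈ (Φ P).1, TropicalFilters.IsRationalPolytope (TropicalFilters.valueGroup S)
          (U : Set (M →+ ℝ))) := by
  refine ⟨fun P hP => hP.1.baseToResidue_injective_of_continuous hS hP.2.2, ?_⟩
  refine ⟨Equiv.ofBijective
    (fun P => ⟨P.2.1.toPFilter hS, P.2.1.isPrime_toPFilter hS P.2.2⟩)
    ⟨fun P P' h => ?_, fun F => ?_⟩,
    fun P => rfl, fun P => P.2.1.mem_contSpec_iff hS P.2.2⟩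
  · exact Subtype.ext (P.2.1.filterOf_injective P'.2.1 hS P.2.2 P'.2.2
      (congrArg (fun F => (F.1 : Set (TropicalFilters.polyhedralLattice
        (TropicalFilters.valueGroup S) M))) h))
  · exact ⟨⟨TropicalFilters.congruenceOf F.1,
      TropicalFilters.isPrimeCongruence_congruenceOf hS F.2,
      TropicalFilters.baseToResidue_congruenceOf_injective F.2⟩,
      Subtype.ext (SetLike.coe_injective (TropicalFilters.filterOf_congruenceOf hS F.2))⟩
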